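/- Let $\lambda=(\lambda_n)$ be a frequency, i.e. a strictly increasing sequence of non-negative real numbers with $\lambda_n\to\infty$, and let $\ell\ge 0$. A Dirichlet series $\sum a_n e^{-\lambda_n s}$ is called a $\lambda$-Riesz germ of a holomorphic function $f:[\mathrm{Re}>0]\to\mathbb{C}$ if for some $m\ge 0$ and some $\sigma\ge 0$ $$f(s)=\lim_{x\to\infty}\sum_{\lambda_n<x}a_n e^{-\lambda_n s}\Big(1-\frac{\lambda_n}{x}\Big)^m\quad\text{for all } s \text{ with } \mathrm{Re}\, s>\sigma.$$ Such a germ, if it exists, is unique, and $a_n(f):=a_n$ are called the Bohr coefficients of $f$. Let $H_{\infty,\ell}^{\lambda}[\mathrm{Re}>0]$ be the space of all holomorphic $f:[\mathrm{Re}>0]\to\mathbb{C}$ which have a $\lambda$-Riesz germ and satisfy $$\|f\|_{\infty,\ell}=\sup_{\mathrm{Re}\, s>0}\frac{|f(s)|}{(1+|s|)^{\ell}}<\infty .$$ (1) Let $(f_N)$ be a bounded sequence in $H_{\infty,\ell}^{\lambda}[\mathrm{Re}>0]$ such that for every $n$ the limit $a_n=\lim_{N\to\infty}a_n(f_N)$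 exists. Then there is $f\in H_{\infty,\ell}^{\lambda}[\mathrm{Re}>0]$ with $a_n(f)=a_n$ for all $n$ and such that, for every $u>0$, $f_N(u+\cdot)\to f(u+\cdot)$ in $H_{\infty,\ell}^{\lambda}[\mathrm{Re}>0]$ as $N\to\infty$. (2) For every bounded sequence $(f_N)$ in $H_{\infty,\ell}^{\lambda}[\mathrm{Re}>0]$ there are a subsequence $(f_{N_j})_j$ and $f\in H_{\infty,\ell}^{\lambda}[\mathrm{Re}>0]$ such that, for every $u>0$, $f_{N_j}(u+\cdot)\to f(u+\cdot)$ in $H_{\infty,\ell}^{\lambda}[\mathrm{Re}>0]$ as $j\to\infty$. -/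

import Mathlib

open Filter Topology

noncomputable section

namespace RieszDirichlet

/-- A frequency: a strictly increasing sequence of non-negative reals tending to infinity. -/
structure IsFrequency (lam : ℕ → ℝ) : Prop where
  strictMono : StrictMono lam
  nonneg : ∀ n, 0 ≤ lam n
  tendsto : Tendsto lam atTop atTop

/-- The Riesz mean of order `m` and length `x` of the Dirichlet series `∑ a n * exp (-lam n * s)`:
the sum of `a n * exp (-lam n * s) * (1 - lam n / x) ^ m` over the (for a frequency `lam`,
finitely many) indices `n` with `lam n < x`. -/
def rieszMean (lam : ℕ → ℝ) (m : ℝ) (a : ℕ → ℂ) (x : ℝ) (s : ℂ) : ℂ :=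
  ∑ᶠ n ∈ {n : ℕ | lam n < x},
    a n * Complex.exp (-(lam n : ℂ) * s) * (((1 - lam n / x) ^ m : ℝ) : ℂ)

/-- `∑ a n * exp (-lam n * s)` is a Riesz germ of `f`, a function on the right half-plane: for some
order `m ≥ 0` its Riesz means converge to `f` pointwise on some half-plane `Re s > σ`. -/
def IsRieszGerm (lam : ℕ → ℝ) (a : ℕ → ℂ) (f : ℂ → ℂ) : Prop :=
  ∃ m : ℝ, 0 ≤ m ∧ ∃ σ : ℝ, 0 ≤ σ ∧ ∀ s : ℂ, σ < s.re →
    Tendsto (fun x : ℝ => rieszMean lam m a x s) atTop (𝓝 (f s))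

open Classical in
/-- The Bohr coefficients of `f`: the coefficient sequence of its (unique) Riesz germ, and `0` if
there is none. -/
def bohrCoeff (lam : ℕ → ℝ) (f : ℂ → ℂ) : ℕ → ℂ :=
  if h : ∃ a : ℕ → ℂ, IsRieszGerm lam a f then h.choose else 0

/-- The norm `sup_{Re s > 0} |f s| / (1 + |s|) ^ ℓ`, with values in `[0, ∞]`. -/
def growthNorm (ℓ : ℝ) (f : ℂ → ℂ) : ENNReal :=
  ⨆ (s : ℂ) (_ : 0 < s.re), ENNReal.ofReal (‖f s‖ / (1 + ‖s‖) ^ ℓ)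

/-- The space of holomorphic functions on the right half-plane that have a Riesz germ and finite
norm. Only the values of `f` on the right half-plane matter. -/
def HSpace (lam : ℕ → ℝ) (ℓ : ℝ) : Set (ℂ → ℂ) :=
  {f | DifferentiableOn ℂ f {s : ℂ | 0 < s.re} ∧ (∃ a : ℕ → ℂ, IsRieszGerm lam a f) ∧
    growthNorm ℓ f < ⊤}

/-- A bounded sequence in `HSpace lam ℓ`. -/
def IsBoundedSeq (lam : ℕ → ℝ) (ℓ : ℝ) (F : ℕ → ℂ → ℂ) : Prop :=
  (∀ N, F N ∈ HSpace lam ℓ) ∧ ∃ C : NNReal, ∀ N, growthNorm ℓ (F N) ≤ C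

/-- The sequence `F` converges to `f` in `HSpace lam ℓ`: all functions belong to the space and the
norms of the differences tend to zero. -/
def ConvergesInH (lam : ℕ → ℝ) (ℓ : ℝ) (F : ℕ → ℂ → ℂ) (f : ℂ → ℂ) : Prop :=
  (∀ N, F N ∈ HSpace lam ℓ) ∧ f ∈ HSpace lam ℓ ∧
    Tendsto (fun N => growthNorm ℓ (fun s => F N s - f s)) atTop (𝓝 0)

/-- The horizontal translate `s ↦ f (u + s)`. -/
def translate (u : ℝ) (f : ℂ → ℂ) : ℂ → ℂ := fun s => f ((u : ℂ) + s)

end RieszDirichlet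

end

/-! The heart is a tail estimate: on `Re s ≥ u > 0` a function of the space is approximated by its
Riesz means of length `y` and any integer order `k > ℓ + 1`, with error at most `C * B / y * (1 +
‖s‖) ^ ℓ`. Here `C` bounds the norm and `B` depends only on `lam`, `ℓ`, `k`, `u`. A Riesz mean
involves finitely many coefficients, so in a bounded family finitely many coefficients control the
weighted distance on `Re s ≥ u`. Convergent coefficients therefore force a Cauchy sequence there,
and the limit inherits growth bound and germ. For part (2) the coefficients are bounded uniformly
over the sequence, and compactness of a product of discs supplies the subsequence.

The estimate comes from Perron's formula `∑ a n * exp (-lam n * s) * (y - lam n)₊ ^ k = k! * ∫ f (s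
+ w) * exp (y w) / w ^ (k + 1)` over `Re w = c`, for `k > ℓ`. With `c = 1 / y` and `w` rescaled, the
Riesz mean becomes an average of `f (s + w / y)` against a kernel of total mass 1
(`integral_exp_div_vline_pow`). A Cauchy estimate for `deriv f` then gives the rate `1 / y`
(`exists_norm_sub_rieszSum_le`).

Perron's formula is Fourier inversion of a Laplace transform (`eq_laplace_rieszSum`,
`eq_integral_of_laplace`), valid at first for large `k` and far to the right. Differentiation in `y`
lowers `k` to any integer above `ℓ`, and the identity theorem in `s` reaches `Re s > 0`; no contour
is shifted. -/

namespace RieszDirichlet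

/-! ### Riesz means and raising the order of summation -/

open MeasureTheory Set

/-- The truncated power `x ↦ max x 0 ^ k`. -/
def truncPow (k : ℕ) (x : ℝ) : ℝ := max x 0 ^ k

/-- The unnormalised Riesz sum `∑ c n * (y - lam n) ^ k` over the indices with `lam n < y`. -/
noncomputable def rieszSum (lam : ℕ → ℝ) (c : ℕ → ℂ) (k : ℕ) (y : ℝ) : ℂ :=
  ∑ᶠ n, c n * (truncPow k (y - lam n) : ℂ)

/-- The coefficients `c n * exp (-lam n * s)` of the Dirichlet series translated by `s`. -/
noncomputable def twist (lam : ℕ → ℝ) (c : ℕ → ℂ) (s : ℂ) (n : ℕ) : ℂ :=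
  c n * Complex.exp (-(lam n : ℂ) * s)

theorem truncPow_nonneg (k : ℕ) (x : ℝ) : 0 ≤ truncPow k x :=
  pow_nonneg (le_max_right _ _) _

theorem truncPow_of_nonneg (k : ℕ) {x : ℝ} (hx : 0 ≤ x) : truncPow k x = x ^ k := by
  rw [truncPow, max_eq_left hx]

theorem truncPow_of_nonpos {k : ℕ} (hk : k ≠ 0) {x : ℝ} (hx : x ≤ 0) : truncPow k x = 0 := by
  rw [truncPow, max_eq_right hx, zero_pow hk]

theorem continuous_truncPow (k : ℕ) : Continuous (truncPow k) := by
  unfold truncPow; fun_prop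

theorem IsFrequency.exists_le {lam : ℕ → ℝ} (hlam : IsFrequency lam) (Y : ℝ) :
    ∃ N, ∀ n, N ≤ n → Y ≤ lam n :=
  eventually_atTop.1 (hlam.tendsto.eventually_ge_atTop Y)

/-- Order zero is excluded because `truncPow 0` is constantly 1, so the terms with `lam n ≥ y` would
not vanish. Any `N` past the cutoff is allowed, so that one index set serves all smaller `y` at
once. -/
theorem rieszSum_eq_sum {lam : ℕ → ℝ} (c : ℕ → ℂ) {k : ℕ} (hk : k ≠ 0) {N : ℕ} {y : ℝ}
    (hN : ∀ n, N ≤ n → y ≤ lam n) :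
    rieszSum lam c k y = ∑ n ∈ Finset.range N, c n * (truncPow k (y - lam n) : ℂ) := by
  refine finsum_eq_sum_of_support_subset _ fun n hn => ?_
  by_contra h
  simp only [Finset.coe_range, mem_Iio, not_lt] at h
  exact hn (by simp [truncPow_of_nonpos hk (sub_nonpos.2 (hN n h))])

theorem rieszMean_eq_sum {lam : ℕ → ℝ} (m : ℝ) (a : ℕ → ℂ) {N : ℕ} {x : ℝ} (s : ℂ)
    (hN : ∀ n, N ≤ n → x ≤ lam n) :
    rieszMean lam m a x s = ∑ n ∈ Finset.range N,
      twist lam a s n * (((if lam n < x then (1 - lam n / x) ^ m else 0) : ℝ) : ℂ) := by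
  have hsub : {n : ℕ | lam n < x} ⊆ Finset.range N := fun n (hn : lam n < x) => by
    simp only [Finset.coe_range, mem_Iio]
    by_contra h
    exact (hN n (by simpa using h)).not_gt hn
  rw [rieszMean, finsum_mem_eq_finite_toFinset_sum _ ((Finset.range N).finite_toSet.subset hsub)]
  refine Finset.sum_subset_zero_on_sdiff (fun n hn => ?_) (fun n hn => ?_) (fun n hn => ?_)
  · exact hsub (by simpa using hn)
  · simp only [Finset.mem_sdiff, Finite.mem_toFinset, mem_ofPred_eq] at hn
    simp [hn.2]
  · simp only [Finite.mem_toFinset, mem_ofPred_eq] at hn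
    simp [hn, twist]

theorem rieszMean_natCast {lam : ℕ → ℝ} (hlam : IsFrequency lam) {k : ℕ} (hk : k ≠ 0)
    (a : ℕ → ℂ) {x : ℝ} (hx : 0 < x) (s : ℂ) :
    rieszMean lam k a x s = rieszSum lam (twist lam a s) k x / (x : ℂ) ^ k := by
  obtain ⟨N, hN⟩ := hlam.exists_le x
  rw [rieszMean_eq_sum _ a s hN, rieszSum_eq_sum _ hk hN, Finset.sum_div]
  refine Finset.sum_congr rfl fun n _ => ?_
  have hx' : (x : ℂ) ≠ 0 := by exact_mod_cast hx.ne'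
  split_ifs with h
  · rw [truncPow_of_nonneg _ (sub_nonneg.2 h.le), Real.rpow_natCast, mul_div_assoc]
    congr 1
    push_cast
    rw [← div_pow, sub_div, div_self hx']
  · simp [truncPow_of_nonpos hk (sub_nonpos.2 (not_lt.1 h))]

/-- With `r = lam / x` one has `t ^ m * (1 - r / t) ^ m = (t - r) ^ m`, and the substitution `t = (1
- r) * v + r` pulls out `(1 - r) ^ (m + q + 1)`, leaving the Beta integral. -/
theorem integral_riesz_average {m q lam x : ℝ} (hlam : 0 ≤ lam)
    (hx : 0 < x) :
    ∫ t in (0:ℝ)..1, t ^ m * (1 - t) ^ q * (if lam < x * t then (1 - lam / (x * t)) ^ m else 0) =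
      (∫ t in (0:ℝ)..1, t ^ m * (1 - t) ^ q) *
        (if lam < x then (1 - lam / x) ^ (m + q + 1) else 0) := by
  split_ifs with h
  swap
  · rw [mul_zero]
    refine intervalIntegral.integral_zero_ae (Eventually.of_forall fun t ht => ?_)
    rw [uIoc_of_le zero_le_one] at ht
    rw [if_neg, mul_zero]
    nlinarith [ht.2, not_lt.1 h]
  set r := lam / x with hr
  have hr0 : 0 ≤ r := by positivity
  have hr1 : r < 1 := (div_lt_one hx).2 h
  have hcond : ∀ t, lam < x * t ↔ r < t := fun t => by rw [hr, div_lt_iff₀ hx, mul_comm]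
  have hdiv : ∀ t, lam / (x * t) = r / t := fun t => by rw [hr, div_div]
  simp only [hcond, hdiv]
  have key : ∀ t ∈ Ioc (0:ℝ) 1, t ^ m * (1 - t) ^ q * (if r < t then (1 - r / t) ^ m else 0) =
      (Ioc r 1).indicator (fun t => (t - r) ^ m * (1 - t) ^ q) t := by
    intro t ht
    by_cases hrt : r < t
    · rw [if_pos hrt, indicator_of_mem (show t ∈ Ioc r 1 from ⟨hrt, ht.2⟩), mul_right_comm,
        ← Real.mul_rpow ht.1.le (by rw [sub_nonneg, div_le_one ht.1]; exact hrt.le), mul_sub,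
        mul_one, mul_div_cancel₀ _ ht.1.ne']
    · rw [if_neg hrt, mul_zero, indicator_of_notMem (fun h => hrt h.1)]
  rw [intervalIntegral.integral_of_le zero_le_one,
    setIntegral_congr_fun measurableSet_Ioc key, setIntegral_indicator measurableSet_Ioc,
    inter_eq_right.2 (Ioc_subset_Ioc_left hr0), ← intervalIntegral.integral_of_le hr1.le]
  have hsub := intervalIntegral.integral_comp_mul_add
    (fun t => (t - r) ^ m * (1 - t) ^ q) (a := 0) (b := 1) (sub_pos.2 hr1).ne' r
  simp only [mul_zero, zero_add, mul_one, sub_add_cancel, smul_eq_mul, add_sub_cancel_right]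
    at hsub
  rw [eq_inv_mul_iff_mul_eq₀ (sub_pos.2 hr1).ne'] at hsub
  rw [← hsub, mul_comm (∫ t in (0:ℝ)..1, t ^ m * (1 - t) ^ q),
    ← intervalIntegral.integral_const_mul, ← intervalIntegral.integral_const_mul]
  refine intervalIntegral.integral_congr fun v hv => ?_
  rw [uIcc_of_le zero_le_one] at hv
  have h1 : 0 < 1 - r := sub_pos.2 hr1
  have h2 : 1 - ((1 - r) * v + r) = (1 - r) * (1 - v) := by ring
  simp only [h2]
  rw [Real.mul_rpow h1.le hv.1, Real.mul_rpow h1.le (sub_nonneg.2 hv.2),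
    Real.rpow_add h1, Real.rpow_add h1, Real.rpow_one]
  ring

theorem norm_rieszMean_le {lam : ℕ → ℝ} (hlam : IsFrequency lam) {m : ℝ} (hm : 0 ≤ m)
    (a : ℕ → ℂ) {N : ℕ} {x : ℝ} (hx : 0 < x) (s : ℂ) (hN : ∀ n, N ≤ n → x ≤ lam n) :
    ‖rieszMean lam m a x s‖ ≤ ∑ n ∈ Finset.range N, ‖twist lam a s n‖ := by
  rw [rieszMean_eq_sum m a s hN]
  refine (norm_sum_le _ _).trans (Finset.sum_le_sum fun n _ => ?_)
  rw [norm_mul]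
  refine mul_le_of_le_one_right (norm_nonneg _) ?_
  rw [Complex.norm_real]
  split_ifs with h
  · have h0 : 0 ≤ 1 - lam n / x := by rw [sub_nonneg, div_le_one hx]; exact h.le
    rw [Real.norm_of_nonneg (Real.rpow_nonneg h0 _)]
    exact Real.rpow_le_one h0 (by linarith [div_nonneg (hlam.nonneg n) hx.le]) hm
  · simp

/-- Large `x` are covered by convergence; for `x` below a threshold only finitely many terms occur,
each with weight at most 1. -/
theorem exists_norm_rieszMean_le {lam : ℕ → ℝ} (hlam : IsFrequency lam) {m : ℝ} (hm : 0 ≤ m)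
    {a : ℕ → ℂ} {s L : ℂ} (h : Tendsto (fun x => rieszMean lam m a x s) atTop (𝓝 L)) :
    ∃ M, ∀ x, 0 < x → ‖rieszMean lam m a x s‖ ≤ M := by
  have h1 : ∀ᶠ x in atTop, ‖rieszMean lam m a x s‖ ≤ ‖L‖ + 1 :=
    h.norm.eventually_le_const (by linarith)
  obtain ⟨x₀, hx₀⟩ := eventually_atTop.1 h1
  obtain ⟨N, hN⟩ := hlam.exists_le x₀
  refine ⟨max (‖L‖ + 1) (∑ n ∈ Finset.range N, ‖twist lam a s n‖), fun x hx => ?_⟩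
  rcases le_total x₀ x with h2 | h2
  · exact (hx₀ x h2).trans (le_max_left _ _)
  · exact (norm_rieszMean_le hlam hm a hx s fun n hn => h2.trans (hN n hn)).trans
      (le_max_right _ _)

/-- Riesz summability of order `m` implies Riesz summability, to the same limit, of every order
`m + q + 1`. -/
theorem tendsto_rieszMean_of_order_le {lam : ℕ → ℝ} (hlam : IsFrequency lam) {m q : ℝ}
    (hm : 0 ≤ m) (hq : 0 ≤ q) {a : ℕ → ℂ} {s L : ℂ}
    (h : Tendsto (fun x => rieszMean lam m a x s) atTop (𝓝 L)) :
    Tendsto (fun x => rieszMean lam (m + q + 1) a x s) atTop (𝓝 L) := by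
  obtain ⟨M, hM⟩ := exists_norm_rieszMean_le hlam hm h
  have hcont : Continuous fun t : ℝ => t ^ m * (1 - t) ^ q :=
    (Real.continuous_rpow_const hm).mul ((Real.continuous_rpow_const hq).comp (by fun_prop))
  set B := ∫ t in (0:ℝ)..1, t ^ m * (1 - t) ^ q with hB
  have hBpos : 0 < B :=
    intervalIntegral.intervalIntegral_pos_of_pos_on (hcont.intervalIntegrable _ _)
      (fun t ht => mul_pos (Real.rpow_pos_of_pos ht.1 _)
        (Real.rpow_pos_of_pos (sub_pos.2 ht.2) _)) zero_lt_one
  have hmeas : ∀ (l x : ℝ), Measurable fun t : ℝ =>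
      (if l < x * t then (1 - l / (x * t)) ^ m else 0) := fun l x =>
    Measurable.ite (measurableSet_lt measurable_const (by fun_prop)) (by fun_prop)
      measurable_const
  have hform : ∀ x, 0 < x → ∀ N, (∀ n, N ≤ n → x ≤ lam n) → ∀ t ∈ Ioc (0:ℝ) 1,
      ((t ^ m * (1 - t) ^ q : ℝ) : ℂ) * rieszMean lam m a (x * t) s =
      ∑ n ∈ Finset.range N, twist lam a s n * ((t ^ m * (1 - t) ^ q *
        (if lam n < x * t then (1 - lam n / (x * t)) ^ m else 0) : ℝ) : ℂ) := by
    intro x hx N hN t ht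
    rw [rieszMean_eq_sum m a s (N := N) fun n hn =>
      (mul_le_of_le_one_right hx.le ht.2).trans (hN n hn), Finset.mul_sum]
    refine Finset.sum_congr rfl fun n _ => ?_
    rw [Complex.ofReal_mul (t ^ m * (1 - t) ^ q)]
    ring
  have hterm : ∀ x, 0 < x → ∀ n, IntervalIntegrable (fun t => t ^ m * (1 - t) ^ q *
        (if lam n < x * t then (1 - lam n / (x * t)) ^ m else 0)) volume 0 1 := by
    intro x hx n
    refine (hcont.intervalIntegrable 0 1).mono_fun
      ((hcont.measurable.mul (hmeas _ _)).aestronglyMeasurable)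
      ((ae_restrict_iff' measurableSet_uIoc).2 (Eventually.of_forall fun t ht => ?_))
    rw [uIoc_of_le zero_le_one] at ht
    dsimp only
    rw [norm_mul _ (ite _ _ _)]
    refine mul_le_of_le_one_right (norm_nonneg _) ?_
    split_ifs with h
    · have hxt : 0 < x * t := mul_pos hx ht.1
      have h0 : 0 ≤ 1 - lam n / (x * t) := by rw [sub_nonneg, div_le_one hxt]; exact h.le
      rw [Real.norm_of_nonneg (Real.rpow_nonneg h0 _)]
      exact Real.rpow_le_one h0 (by linarith [div_nonneg (hlam.nonneg n) hxt.le]) hm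
    · simp
  -- The mean of order `m + q + 1` at `x` is the Beta-weighted average over `0 < t ≤ 1` of the means
  -- of order `m` at `x * t`. Each `x * t` tends to infinity, so dominated convergence applies.
  have havg : ∀ x, 0 < x → (∫ t in (0:ℝ)..1, ((t ^ m * (1 - t) ^ q : ℝ) : ℂ) *
      rieszMean lam m a (x * t) s) = (B : ℂ) * rieszMean lam (m + q + 1) a x s := by
    intro x hx
    obtain ⟨N, hN⟩ := hlam.exists_le x
    rw [rieszMean_eq_sum _ a s hN, Finset.mul_sum,
      intervalIntegral.integral_of_le zero_le_one,
      setIntegral_congr_fun measurableSet_Ioc (hform x hx N hN),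
      ← intervalIntegral.integral_of_le zero_le_one, intervalIntegral.integral_finsetSum
        fun n _ => (IntervalIntegrable.const_mul
          ⟨(hterm x hx n).1.ofReal, (hterm x hx n).2.ofReal⟩ _)]
    refine Finset.sum_congr rfl fun n _ => ?_
    rw [intervalIntegral.integral_const_mul, intervalIntegral.integral_ofReal,
      integral_riesz_average (hlam.nonneg n) hx]
    push_cast
    ring
  have hlim : Tendsto (fun x => ∫ t in (0:ℝ)..1, ((t ^ m * (1 - t) ^ q : ℝ) : ℂ) *
      rieszMean lam m a (x * t) s) atTop
      (𝓝 (∫ t in (0:ℝ)..1, ((t ^ m * (1 - t) ^ q : ℝ) : ℂ) * L)) := by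
    refine intervalIntegral.tendsto_integral_filter_of_dominated_convergence
      (fun t => ‖t ^ m * (1 - t) ^ q‖ * M) ?_ ?_ ?_ ?_
    · filter_upwards [eventually_gt_atTop 0] with x hx
      obtain ⟨N, hN⟩ := hlam.exists_le x
      have : AEStronglyMeasurable (fun t => ∑ n ∈ Finset.range N, twist lam a s n *
          ((t ^ m * (1 - t) ^ q * (if lam n < x * t then (1 - lam n / (x * t)) ^ m else 0) : ℝ) :
          ℂ)) (volume.restrict (uIoc 0 1)) :=
        (Finset.measurable_sum _ fun n _ => measurable_const.mul
          (Complex.measurable_ofReal.comp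
            (hcont.measurable.mul (hmeas (lam n) x)))).aestronglyMeasurable
      refine this.congr ((ae_restrict_iff' measurableSet_uIoc).2
        (Eventually.of_forall fun t ht => ?_))
      rw [uIoc_of_le zero_le_one] at ht
      exact (hform x hx N hN t ht).symm
    · filter_upwards [eventually_gt_atTop 0] with x hx
      refine Eventually.of_forall fun t ht => ?_
      rw [uIoc_of_le zero_le_one] at ht
      rw [norm_mul, Complex.norm_real]
      exact mul_le_mul_of_nonneg_left (hM _ (mul_pos hx ht.1)) (norm_nonneg _)
    · exact (hcont.norm.mul continuous_const).intervalIntegrable _ _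
    · refine Eventually.of_forall fun t ht => ?_
      rw [uIoc_of_le zero_le_one] at ht
      exact (h.comp (tendsto_id.atTop_mul_const ht.1)).const_mul _
  rw [intervalIntegral.integral_mul_const, intervalIntegral.integral_ofReal, ← hB] at hlim
  have hBc : (B : ℂ) ≠ 0 := by exact_mod_cast hBpos.ne'
  have := hlim.const_mul (B : ℂ)⁻¹
  rw [inv_mul_cancel_left₀ hBc] at this
  refine this.congr' ?_
  filter_upwards [eventually_gt_atTop 0] with x hx
  rw [havg x hx, inv_mul_cancel_left₀ hBc]

theorem tendsto_rieszSum_of_tendsto_rieszMean {lam : ℕ → ℝ} (hlam : IsFrequency lam) {m : ℝ}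
    (hm : 0 ≤ m) {a : ℕ → ℂ} {s L : ℂ} {k : ℕ} (hk : m + 1 ≤ k)
    (h : Tendsto (fun x => rieszMean lam m a x s) atTop (𝓝 L)) :
    Tendsto (fun x : ℝ => rieszSum lam (twist lam a s) k x / (x : ℂ) ^ k) atTop (𝓝 L) := by
  have h1 := tendsto_rieszMean_of_order_le hlam hm (sub_nonneg.2 hk) h
  have hk0 : k ≠ 0 := by
    rintro rfl
    norm_num at hk
    linarith
  refine h1.congr' ?_
  filter_upwards [eventually_gt_atTop 0] with x hx
  rw [← rieszMean_natCast hlam hk0 a hx]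
  congr 1
  ring

end RieszDirichlet

namespace RieszDirichlet

/-! ### Laplace transform of the Riesz sums -/

open MeasureTheory Set Polynomial

/-- The operator with `d/dy (exp (-y w) P(X - y)) = exp (-y w) (expDeriv w P)(X - y)`. -/
noncomputable def expDeriv (w : ℂ) (P : ℂ[X]) : ℂ[X] := -(C w * P + derivative P)

theorem X_pow_dvd_expDeriv (w : ℂ) {P : ℂ[X]} {n : ℕ} (h : X ^ (n + 1) ∣ P) :
    X ^ n ∣ expDeriv w P :=
  (dvd_neg).2 (dvd_add (dvd_mul_of_dvd_right ((pow_dvd_pow X n.le_succ).trans h) _)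
    (by simpa using pow_sub_one_dvd_derivative_of_pow_dvd h))

/-- Each application costs at most one factor `X`. Hence the iterates of order `j < K` vanish at 0,
which kills the boundary terms at `y = x` in the integrations by parts. -/
theorem X_pow_dvd_iterate_expDeriv (w : ℂ) (K : ℕ) :
    ∀ j ≤ K, X ^ (K - j) ∣ (expDeriv w)^[j] (X ^ K) := by
  intro j
  induction j with
  | zero => simp
  | succ j ih =>
    intro hj
    rw [Function.iterate_succ_apply']
    refine X_pow_dvd_expDeriv w ?_
    rw [show K - (j + 1) + 1 = K - j by omega]
    exact ih (by omega)

theorem natDegree_expDeriv_le (w : ℂ) {P : ℂ[X]} {K : ℕ} (h : P.natDegree ≤ K) :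
    (expDeriv w P).natDegree ≤ K := by
  rw [expDeriv, natDegree_neg]
  exact natDegree_add_le_of_degree_le ((natDegree_C_mul_le _ _).trans h)
    ((natDegree_derivative_le _).trans (by omega))

theorem coeff_expDeriv (w : ℂ) {P : ℂ[X]} {K : ℕ} (h : P.natDegree ≤ K) :
    (expDeriv w P).coeff K = -w * P.coeff K := by
  rw [expDeriv, coeff_neg, coeff_add, coeff_C_mul, coeff_derivative,
    coeff_eq_zero_of_natDegree_lt (show P.natDegree < K + 1 by omega)]
  ring

/-- The derivative part lowers the degree, so only multiplication by `-w` acts on the top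
coefficient. That coefficient is all that survives division by `x ^ K` as `x → ∞`. -/
theorem iterate_expDeriv_top (w : ℂ) (K j : ℕ) :
    ((expDeriv w)^[j] (X ^ K)).natDegree ≤ K ∧
      ((expDeriv w)^[j] (X ^ K)).coeff K = (-w) ^ j := by
  induction j with
  | zero => simp
  | succ j ih =>
    rw [Function.iterate_succ_apply', coeff_expDeriv w ih.1, ih.2]
    exact ⟨natDegree_expDeriv_le w ih.1, by ring⟩

theorem hasDerivAt_exp_mul_eval (w : ℂ) (P : ℂ[X]) (x y : ℝ) :
    HasDerivAt (fun y : ℝ => Complex.exp (-(y : ℂ) * w) * P.eval ((x : ℂ) - y))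
      (Complex.exp (-(y : ℂ) * w) * (expDeriv w P).eval ((x : ℂ) - y)) y := by
  have h0 : HasDerivAt (fun z : ℂ => Complex.exp (-z * w) * P.eval ((x : ℂ) - z))
      (Complex.exp (-(y : ℂ) * w) * (-1 * w) * P.eval ((x : ℂ) - y) +
        Complex.exp (-(y : ℂ) * w) * (P.derivative.eval ((x : ℂ) - y) * (-1))) (y : ℂ) := by
    refine HasDerivAt.mul ?_ ?_
    · exact (((hasDerivAt_id _).neg).mul_const w).cexp
    · exact (P.hasDerivAt ((x : ℂ) - y)).comp (y : ℂ) ((hasDerivAt_id _).const_sub _)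
  refine h0.comp_ofReal.congr_deriv ?_
  simp only [expDeriv, eval_neg, eval_add, eval_mul, eval_C]
  ring

/-- Repeated integration by parts against the truncated power `(y - l) ^ k`. -/
theorem integral_pow_mul_iterate_expDeriv (w : ℂ) (P : ℂ[X]) (l x : ℝ) (k : ℕ)
    (h : ∀ j ≤ k, ((expDeriv w)^[j] P).eval 0 = 0) :
    ∫ y in l..x, ((y : ℂ) - l) ^ k *
        (Complex.exp (-(y : ℂ) * w) * ((expDeriv w)^[k + 1] P).eval ((x : ℂ) - y)) =
      (-1) ^ (k + 1) * (k.factorial : ℂ) * (Complex.exp (-(l : ℂ) * w) * P.eval ((x : ℂ) - l)) := by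
  have hcont : ∀ Q : ℂ[X], Continuous fun y : ℝ =>
      Complex.exp (-(y : ℂ) * w) * Q.eval ((x : ℂ) - y) := fun Q =>
    (by fun_prop : Continuous fun y : ℝ => Complex.exp (-(y : ℂ) * w)).mul
      (Q.continuous.comp (by fun_prop))
  induction k with
  | zero =>
    -- For `k = 0` no power of `y - l` vanishes at the lower endpoint; this is the only boundary
    -- term that survives, and it produces the right-hand side.
    have := intervalIntegral.integral_eq_sub_of_hasDerivAt
      (fun y _ => hasDerivAt_exp_mul_eval w P x y) ((hcont _).intervalIntegrable l x)
    have h0 := h 0 le_rfl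
    simp only [Function.iterate_zero, id_eq] at h0
    simp only [pow_zero, one_mul, zero_add, Function.iterate_one, this, sub_self, h0]
    simp
  | succ k ih =>
    have ih' := ih fun j hj => h j (by omega)
    have hu : ∀ y : ℝ, HasDerivAt (fun y : ℝ => ((y : ℂ) - l) ^ (k + 1))
        (((k + 1 : ℕ) : ℂ) * ((y : ℂ) - l) ^ k) y := fun y => by
      have : HasDerivAt (fun z : ℂ => (z - l) ^ (k + 1))
          (((k + 1 : ℕ) : ℂ) * ((y : ℂ) - l) ^ k * 1) (y : ℂ) :=
        ((hasDerivAt_id (y : ℂ)).sub_const (l : ℂ)).pow (k + 1)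
      simpa using this.comp_ofReal
    have hv := fun y : ℝ => hasDerivAt_exp_mul_eval w ((expDeriv w)^[k + 1] P) x y
    have hparts := intervalIntegral.integral_mul_deriv_eq_deriv_mul (a := l) (b := x)
      (fun y _ => hu y) (fun y _ => hv y)
      ((by fun_prop : Continuous fun y : ℝ => ((k + 1 : ℕ) : ℂ) * ((y : ℂ) - l) ^ k)
        |>.intervalIntegrable _ _) ((hcont _).intervalIntegrable _ _)
    rw [Function.iterate_succ_apply' (expDeriv w) (k + 1), hparts]
    simp only [sub_self, h (k + 1) le_rfl, mul_zero, mul_assoc]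
    rw [intervalIntegral.integral_const_mul, ih', Nat.factorial_succ]
    push_cast
    ring

/-- The polynomial for which `exp (-y w) * (rieszPoly k w)(x - y)` is the derivative of order `k + 1`
of `exp (-y w) * (x - y) ^ (k + 1)`. -/
noncomputable def rieszPoly (k : ℕ) (w : ℂ) : ℂ[X] := (expDeriv w)^[k + 1] (X ^ (k + 1))

theorem eval_rieszPoly_div (k : ℕ) (w : ℂ) (z x : ℂ) :
    (rieszPoly k w).eval z / x ^ (k + 1) =
      ∑ i ∈ Finset.range (k + 2), (rieszPoly k w).coeff i * (z ^ i / x ^ (k + 1)) := by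
  rw [eval_eq_sum_range' (n := k + 2)
    (by have := (iterate_expDeriv_top w (k + 1) (k + 1)).1; rw [rieszPoly]; omega),
    Finset.sum_div]
  exact Finset.sum_congr rfl fun i _ => mul_div_assoc _ _ _

theorem norm_rieszPoly_div_le (k : ℕ) (w : ℂ) {x y : ℝ} (hx : 1 ≤ x) (hy : 0 ≤ y) (hyx : y ≤ x) :
    ‖(rieszPoly k w).eval ((x : ℂ) - y) / (x : ℂ) ^ (k + 1)‖ ≤
      ∑ i ∈ Finset.range (k + 2), ‖(rieszPoly k w).coeff i‖ := by
  rw [eval_rieszPoly_div]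
  refine (norm_sum_le _ _).trans (Finset.sum_le_sum fun i hi => ?_)
  rw [norm_mul]
  refine mul_le_of_le_one_right (norm_nonneg _) ?_
  rw [norm_div, norm_pow, norm_pow, ← Complex.ofReal_sub, Complex.norm_real, Complex.norm_real,
    Real.norm_of_nonneg (sub_nonneg.2 hyx), Real.norm_of_nonneg (by linarith)]
  refine div_le_one_of_le₀ ?_ (by positivity)
  calc (x - y) ^ i ≤ x ^ i := pow_le_pow_left₀ (sub_nonneg.2 hyx) (by linarith) _
    _ ≤ x ^ (k + 1) := pow_le_pow_right₀ hx (by have := Finset.mem_range.1 hi; omega)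

theorem tendsto_rieszPoly_div (k : ℕ) (w : ℂ) (y : ℝ) :
    Tendsto (fun x : ℝ => (rieszPoly k w).eval ((x : ℂ) - y) / (x : ℂ) ^ (k + 1)) atTop
      (𝓝 ((-w) ^ (k + 1))) := by
  have hinv : Tendsto (fun x : ℝ => ((x⁻¹ : ℝ) : ℂ)) atTop (𝓝 0) := by
    exact (Complex.continuous_ofReal.tendsto' 0 0 (by simp)).comp tendsto_inv_atTop_zero
  have hratio : Tendsto (fun x : ℝ => 1 - (y : ℂ) * ((x⁻¹ : ℝ) : ℂ)) atTop (𝓝 1) := by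
    simpa using (hinv.const_mul (y : ℂ)).const_sub 1
  have hsum : Tendsto (fun x : ℝ => ∑ i ∈ Finset.range (k + 2), (rieszPoly k w).coeff i *
      ((1 - (y : ℂ) * ((x⁻¹ : ℝ) : ℂ)) ^ i * ((x⁻¹ : ℝ) : ℂ) ^ (k + 1 - i))) atTop
      (𝓝 (∑ i ∈ Finset.range (k + 2), (rieszPoly k w).coeff i *
        (1 ^ i * 0 ^ (k + 1 - i)))) :=
    tendsto_finsetSum _ fun i _ => ((hratio.pow i).mul (hinv.pow _)).const_mul _
  have hval : ∑ i ∈ Finset.range (k + 2), (rieszPoly k w).coeff i *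
        ((1 : ℂ) ^ i * 0 ^ (k + 1 - i)) = (-w) ^ (k + 1) := by
    rw [Finset.sum_range_succ, Finset.sum_eq_zero fun i hi => ?_]
    · rw [rieszPoly, (iterate_expDeriv_top w (k + 1) (k + 1)).2]
      simp
    · rw [zero_pow (by have := Finset.mem_range.1 hi; omega)]
      simp
  rw [hval] at hsum
  refine hsum.congr' ?_
  filter_upwards [eventually_gt_atTop 0] with x hx
  rw [eval_rieszPoly_div]
  refine Finset.sum_congr rfl fun i hi => ?_
  have hx' : (x : ℂ) ≠ 0 := by exact_mod_cast hx.ne'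
  have hi' : i ≤ k + 1 := by have := Finset.mem_range.1 hi; omega
  rw [← Nat.sub_add_cancel hi', pow_add _ (k + 1 - i) i, Nat.sub_add_cancel hi']
  have : (1 : ℂ) - y * ((x⁻¹ : ℝ) : ℂ) = (x - y) / x := by
    push_cast
    field_simp
  rw [this, div_pow, Complex.ofReal_inv, inv_pow]
  field_simp

/-- The integrand vanishes on `[0, l]`, and beyond `l` repeated integration by parts applies. Summed
over the frequencies, this turns the order-`k` sum of `c` into the order-`k + 1` sum of the twisted
coefficients. -/
theorem integral_truncPow_mul_rieszPoly {k : ℕ} (hk : k ≠ 0) (w : ℂ) {l x : ℝ} (hl : 0 ≤ l)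
    (hx : 0 ≤ x) :
    ∫ y in (0:ℝ)..x, (truncPow k (y - l) : ℂ) *
        (Complex.exp (-(y : ℂ) * w) * (rieszPoly k w).eval ((x : ℂ) - y)) =
      (-1) ^ (k + 1) * (k.factorial : ℂ) *
        (Complex.exp (-(l : ℂ) * w) * (truncPow (k + 1) (x - l) : ℂ)) := by
  have hcont : Continuous fun y : ℝ => (truncPow k (y - l) : ℂ) *
        (Complex.exp (-(y : ℂ) * w) * (rieszPoly k w).eval ((x : ℂ) - y)) :=
    (Complex.continuous_ofReal.comp ((continuous_truncPow k).comp (by fun_prop))).mul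
      ((by fun_prop : Continuous fun y : ℝ => Complex.exp (-(y : ℂ) * w)).mul
      ((rieszPoly k w).continuous.comp (by fun_prop)))
  have hzero : ∀ b ≤ l, 0 ≤ b → ∫ y in (0:ℝ)..b, (truncPow k (y - l) : ℂ) *
        (Complex.exp (-(y : ℂ) * w) * (rieszPoly k w).eval ((x : ℂ) - y)) = 0 := by
    intro b hb hb0
    refine intervalIntegral.integral_zero_ae (Eventually.of_forall fun y hy => ?_)
    rw [uIoc_of_le hb0] at hy
    simp [truncPow_of_nonpos hk (show y - l ≤ 0 by linarith [hy.2])]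
  rcases le_total x l with h | h
  · rw [hzero x h hx, truncPow_of_nonpos k.succ_ne_zero (sub_nonpos.2 h)]
    simp
  · rw [← intervalIntegral.integral_add_adjacent_intervals (hcont.intervalIntegrable 0 l)
      (hcont.intervalIntegrable l x), hzero l le_rfl hl, zero_add,
      truncPow_of_nonneg _ (sub_nonneg.2 h)]
    have hvanish : ∀ j ≤ k, ((expDeriv w)^[j] (X ^ (k + 1) : ℂ[X])).eval 0 = 0 := fun j hj => by
      have h1 := X_pow_dvd_iterate_expDeriv w (k + 1) j (by omega)
      exact eval_eq_zero_of_dvd_of_eval_eq_zero h1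
        (by simp [zero_pow (show k + 1 - j ≠ 0 by omega)])
    have := integral_pow_mul_iterate_expDeriv w (X ^ (k + 1)) l x k hvanish
    simp only [eval_pow, eval_X] at this
    push_cast
    rw [← this]
    refine intervalIntegral.integral_congr fun y hy => ?_
    rw [uIcc_of_le h] at hy
    simp only [rieszPoly]
    rw [truncPow_of_nonneg _ (sub_nonneg.2 hy.1)]
    push_cast
    rfl

theorem continuous_rieszSum {lam : ℕ → ℝ} (hlam : IsFrequency lam) (c : ℕ → ℂ) {k : ℕ}
    (hk : k ≠ 0) : Continuous (rieszSum lam c k) := by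
  refine continuous_iff_continuousAt.2 fun y => ?_
  obtain ⟨N, hN⟩ := hlam.exists_le (y + 1)
  have : Continuous fun y => ∑ n ∈ Finset.range N, c n * (truncPow k (y - lam n) : ℂ) :=
    continuous_finsetSum _ fun n _ => continuous_const.mul
      (Complex.continuous_ofReal.comp ((continuous_truncPow k).comp (by fun_prop)))
  refine this.continuousAt.congr ?_
  filter_upwards [Iio_mem_nhds (lt_add_one y)] with z hz
  exact (rieszSum_eq_sum c hk fun n hn => (le_of_lt hz).trans (hN n hn)).symm

theorem rieszSum_of_nonpos {lam : ℕ → ℝ} (hlam : IsFrequency lam) (c : ℕ → ℂ) {k : ℕ}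
    (hk : k ≠ 0) {y : ℝ} (hy : y ≤ 0) : rieszSum lam c k y = 0 := by
  rw [rieszSum_eq_sum c hk (N := 0) fun n _ => hy.trans (hlam.nonneg n)]
  simp

/-- A Dirichlet series whose Riesz sums of order `k` are `O(y ^ k)` is represented in the right
half-plane by the Laplace transform of these Riesz sums. -/
theorem eq_laplace_rieszSum {lam : ℕ → ℝ} (hlam : IsFrequency lam) {c : ℕ → ℂ} {k : ℕ}
    (hk : k ≠ 0) {M : ℝ} (hM : ∀ y, 0 < y → ‖rieszSum lam c k y‖ ≤ M * y ^ k) {w : ℂ}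
    (hw : 0 < w.re) {L : ℂ}
    (h : Tendsto (fun x : ℝ => rieszSum lam (twist lam c w) (k + 1) x / (x : ℂ) ^ (k + 1)) atTop
      (𝓝 L)) :
    L * k.factorial = w ^ (k + 1) *
      ∫ y in Ioi (0:ℝ), rieszSum lam c k y * Complex.exp (-(y : ℂ) * w) := by
  set B := ∑ i ∈ Finset.range (k + 2), ‖(rieszPoly k w).coeff i‖ with hB
  have hA := continuous_rieszSum hlam c hk
  have hcont : ∀ x : ℝ, Continuous fun y : ℝ => rieszSum lam c k y * (Complex.exp (-(y : ℂ) * w) *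
      ((rieszPoly k w).eval ((x : ℂ) - y) / (x : ℂ) ^ (k + 1))) := fun x =>
    hA.mul ((by fun_prop : Continuous fun y : ℝ => Complex.exp (-(y : ℂ) * w)).mul
      (((rieszPoly k w).continuous.comp (by fun_prop)).div_const _))
  -- The indicator moves the integral over `(0, x]` to the fixed domain `(0, ∞)`, as dominated
  -- convergence in `x` requires.
  have hrep : ∀ x : ℝ, 0 < x → (∫ y in Ioi (0:ℝ), (Iic x).indicator (fun y : ℝ =>
      rieszSum lam c k y * (Complex.exp (-(y : ℂ) * w) *
        ((rieszPoly k w).eval ((x : ℂ) - y) / (x : ℂ) ^ (k + 1)))) y) =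
      (-1) ^ (k + 1) * (k.factorial : ℂ) *
        (rieszSum lam (twist lam c w) (k + 1) x / (x : ℂ) ^ (k + 1)) := by
    intro x hx
    obtain ⟨N, hN⟩ := hlam.exists_le x
    rw [setIntegral_indicator measurableSet_Iic, Ioi_inter_Iic,
      rieszSum_eq_sum _ k.succ_ne_zero hN, ← mul_div_assoc, Finset.mul_sum, Finset.sum_div]
    have : ∀ y ∈ Ioc 0 x, rieszSum lam c k y * (Complex.exp (-(y : ℂ) * w) *
        ((rieszPoly k w).eval ((x : ℂ) - y) / (x : ℂ) ^ (k + 1))) =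
        ∑ n ∈ Finset.range N, c n / (x : ℂ) ^ (k + 1) * ((truncPow k (y - lam n) : ℂ) *
          (Complex.exp (-(y : ℂ) * w) * (rieszPoly k w).eval ((x : ℂ) - y))) := by
      intro y hy
      rw [rieszSum_eq_sum c hk fun n hn => hy.2.trans (hN n hn), Finset.sum_mul]
      exact Finset.sum_congr rfl fun n _ => by ring
    rw [setIntegral_congr_fun measurableSet_Ioc this, ← intervalIntegral.integral_of_le hx.le,
      intervalIntegral.integral_finsetSum fun n _ => ?_]
    · refine Finset.sum_congr rfl fun n _ => ?_
      rw [intervalIntegral.integral_const_mul,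
        integral_truncPow_mul_rieszPoly hk w (hlam.nonneg n) hx.le, twist]
      ring
    · exact (continuous_const.mul ((Complex.continuous_ofReal.comp
        ((continuous_truncPow k).comp (by fun_prop))).mul
        ((by fun_prop : Continuous fun y : ℝ => Complex.exp (-(y : ℂ) * w)).mul
        ((rieszPoly k w).continuous.comp (by fun_prop))))).intervalIntegrable _ _
  have hlim : Tendsto (fun x : ℝ => ∫ y in Ioi (0:ℝ), (Iic x).indicator (fun y : ℝ =>
      rieszSum lam c k y * (Complex.exp (-(y : ℂ) * w) *
        ((rieszPoly k w).eval ((x : ℂ) - y) / (x : ℂ) ^ (k + 1)))) y) atTop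
      (𝓝 (∫ y in Ioi (0:ℝ), rieszSum lam c k y * (Complex.exp (-(y : ℂ) * w) *
        (-w) ^ (k + 1)))) := by
    refine tendsto_integral_filter_of_dominated_convergence
      (fun y => M * B * (y ^ (k : ℝ) * Real.exp (-w.re * y))) ?_ ?_ ?_ ?_
    · exact Eventually.of_forall fun x =>
        ((hcont x).measurable.indicator measurableSet_Iic).aestronglyMeasurable
    · filter_upwards [eventually_ge_atTop 1] with x hx
      refine (ae_restrict_iff' measurableSet_Ioi).2 (Eventually.of_forall fun y hy => ?_)
      have hy0 : 0 < y := hy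
      have hM0 : 0 ≤ M * y ^ k := (norm_nonneg _).trans (hM y hy0)
      have hexp : ‖Complex.exp (-(y : ℂ) * w)‖ = Real.exp (-w.re * y) := by
        rw [Complex.norm_exp]
        congr 1
        simp [mul_comm]
      have hbound : M * B * (y ^ (k : ℝ) * Real.exp (-w.re * y)) =
          M * y ^ k * (Real.exp (-w.re * y) * B) := by
        rw [Real.rpow_natCast]; ring
      rw [hbound]
      by_cases hyx : y ≤ x
      · rw [indicator_of_mem (show y ∈ Iic x from hyx), norm_mul, norm_mul, hexp]
        exact mul_le_mul (hM y hy0) (mul_le_mul_of_nonneg_left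
          (norm_rieszPoly_div_le k w hx hy0.le hyx) (Real.exp_nonneg _)) (by positivity) hM0
      · rw [indicator_of_notMem (show y ∉ Iic x from hyx), norm_zero]
        exact mul_nonneg hM0 (mul_nonneg (Real.exp_nonneg _)
          (Finset.sum_nonneg fun _ _ => norm_nonneg _))
    · exact (integrableOn_rpow_mul_exp_neg_mul_rpow (p := 1) (s := k) 
        (by linarith [k.cast_nonneg (α := ℝ)]) one_pos hw |>.congr_fun (fun y _ => by simp) measurableSet_Ioi).const_mul _
    · refine Eventually.of_forall fun y => ?_
      refine (((tendsto_rieszPoly_div k w y).const_mul _).const_mul _).congr' ?_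
      filter_upwards [eventually_ge_atTop y] with x hx
      rw [indicator_of_mem (show y ∈ Iic x from hx)]
  have hlim2 := (h.const_mul ((-1) ^ (k + 1) * (k.factorial : ℂ)))
  have huniq := tendsto_nhds_unique (hlim2.congr' ?_) hlim
  · have : ∀ y : ℝ, rieszSum lam c k y * (Complex.exp (-(y : ℂ) * w) * (-w) ^ (k + 1)) =
        (-1) ^ (k + 1) * w ^ (k + 1) * (rieszSum lam c k y * Complex.exp (-(y : ℂ) * w)) := by
      intro y
      rw [neg_pow w]
      ring
    simp only [this] at huniq
    rw [integral_const_mul, mul_assoc, mul_assoc] at huniq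
    rw [mul_comm L]
    exact mul_left_cancel₀ (pow_ne_zero _ (by norm_num)) huniq
  · filter_upwards [eventually_gt_atTop 0] with x hx
    exact (hrep x hx).symm

end RieszDirichlet

namespace RieszDirichlet

/-! ### Perron's formula by Fourier inversion -/

open MeasureTheory Set FourierTransform

/-- A parametrisation of the vertical line `Re w = c`. -/
noncomputable def vline (c ξ : ℝ) : ℂ := c + (2 * Real.pi * ξ : ℝ) * Complex.I

@[simp] theorem vline_re (c ξ : ℝ) : (vline c ξ).re = c := by simp [vline]

theorem continuous_vline (c : ℝ) : Continuous (vline c) := by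
  unfold vline; fun_prop

theorem le_norm_vline {c : ℝ} (hc : 0 < c) (ξ : ℝ) : c ≤ ‖vline c ξ‖ := by
  have := Complex.abs_re_le_norm (vline c ξ)
  rwa [vline_re, abs_of_pos hc] at this

theorem norm_vline_pos {c : ℝ} (hc : 0 < c) (ξ : ℝ) : 0 < ‖vline c ξ‖ :=
  hc.trans_le (le_norm_vline hc ξ)

theorem vline_ne_zero {c : ℝ} (hc : 0 < c) (ξ : ℝ) : vline c ξ ≠ 0 :=
  norm_pos_iff.1 (norm_vline_pos hc ξ)

theorem one_le_mul_norm_vline {c : ℝ} (hc : 0 < c) (ξ : ℝ) : 1 ≤ c⁻¹ * ‖vline c ξ‖ := by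
  rw [← inv_mul_cancel₀ hc.ne']
  exact mul_le_mul_of_nonneg_left (le_norm_vline hc ξ) (by positivity)

theorem one_add_abs_le_mul_norm_vline {c : ℝ} (hc : 0 < c) (ξ : ℝ) :
    1 + |ξ| ≤ (c⁻¹ + 1) * ‖vline c ξ‖ := by
  have h := Complex.abs_im_le_norm (vline c ξ)
  have him : (vline c ξ).im = 2 * Real.pi * ξ := by simp [vline]
  rw [him, abs_mul, abs_of_pos Real.two_pi_pos] at h
  have h2 : |ξ| ≤ 2 * Real.pi * |ξ| :=
    le_mul_of_one_le_left (abs_nonneg _) (by linarith [Real.two_le_pi])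
  linarith [one_le_mul_norm_vline hc ξ]

theorem integrable_norm_vline_rpow {c r : ℝ} (hc : 0 < c) (hr : 1 < r) :
    Integrable fun ξ => ‖vline c ξ‖ ^ (-r) := by
  have h1 : Integrable fun ξ : ℝ => (c⁻¹ + 1) ^ r * (1 + ‖ξ‖) ^ (-r) :=
    (integrable_one_add_norm (by simpa using hr)).const_mul _
  have hcont : Continuous fun ξ => ‖vline c ξ‖ ^ (-r) :=
    (continuous_vline c).norm.rpow_const fun ξ => Or.inl (norm_vline_pos hc ξ).ne'
  refine h1.mono' hcont.aestronglyMeasurable (Eventually.of_forall fun ξ => ?_)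
  have hp := norm_vline_pos hc ξ
  have hk : 0 < c⁻¹ + 1 := by positivity
  have h2 := one_add_abs_le_mul_norm_vline hc ξ
  rw [Real.norm_of_nonneg (by positivity), Real.rpow_neg hp.le,
    Real.rpow_neg (by positivity), ← div_eq_mul_inv, le_div_iff₀ (by positivity),
    inv_mul_le_iff₀ (by positivity), ← Real.mul_rpow (by positivity) hk.le, mul_comm ‖_‖]
  exact Real.rpow_le_rpow (by positivity) h2 (by linarith)

theorem integrableOn_mul_exp_of_le_pow {A : ℝ → ℂ} (hA : Continuous A) {k : ℕ} {M : ℝ}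
    (hM : ∀ y, 0 < y → ‖A y‖ ≤ M * y ^ k) {w : ℂ} (hw : 0 < w.re) :
    IntegrableOn (fun y : ℝ => A y * Complex.exp (-(y : ℂ) * w)) (Ioi 0) := by
  have h1 : IntegrableOn (fun y : ℝ => M * (y ^ (k : ℝ) * Real.exp (-w.re * y))) (Ioi 0) :=
    (integrableOn_rpow_mul_exp_neg_mul_rpow (p := 1) (s := k)
      (by linarith [k.cast_nonneg (α := ℝ)]) one_pos hw |>.congr_fun (fun y _ => by simp)
      measurableSet_Ioi).const_mul _
  refine h1.mono' (hA.mul (by fun_prop)).aestronglyMeasurable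
    ((ae_restrict_iff' measurableSet_Ioi).2 (Eventually.of_forall fun y hy => ?_))
  have hexp : ‖Complex.exp (-(y : ℂ) * w)‖ = Real.exp (-w.re * y) := by
    rw [Complex.norm_exp]
    congr 1
    simp [mul_comm]
  rw [norm_mul, hexp, Real.rpow_natCast, ← mul_assoc]
  exact mul_le_mul_of_nonneg_right (hM y hy) (Real.exp_nonneg _)

/-- Inversion of the Laplace transform of a continuous function. -/
theorem eq_integral_of_laplace {A : ℝ → ℂ} (hA : Continuous A) (hA0 : ∀ y ≤ 0, A y = 0) {c : ℝ}
    (hint : IntegrableOn (fun y : ℝ => A y * Complex.exp (-(y : ℂ) * c)) (Ioi 0)) {G : ℂ → ℂ}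
    (hG : ∀ ξ : ℝ, ∫ y in Ioi (0:ℝ), A y * Complex.exp (-(y : ℂ) * vline c ξ) = G (vline c ξ))
    (hGint : Integrable fun ξ => G (vline c ξ)) (y : ℝ) :
    A y = ∫ ξ, G (vline c ξ) * Complex.exp (y * vline c ξ) := by
  -- Since `vline` contains the factor `2 * π`, the Laplace transform of `A` on `Re w = c` is
  -- exactly the Fourier transform of this damped function, and the inversion formula carries no
  -- constant.
  set h : ℝ → ℂ := fun y => A y * Complex.exp (-(y : ℂ) * c) with hh
  have hcont : Continuous h := hA.mul (by fun_prop)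
  have hsupp : Function.support h ⊆ Ioi 0 := fun y hy => by
    by_contra hy'
    exact hy (by simp [hh, hA0 y (not_lt.1 hy')])
  have hhint : Integrable h := (integrableOn_iff_integrable_of_support_subset hsupp).1 hint
  have hF : 𝓕 h = fun ξ => G (vline c ξ) := by
    ext ξ
    rw [Real.fourier_real_eq_integral_exp_smul, ← hG ξ,
      ← setIntegral_eq_integral_of_forall_compl_eq_zero (s := Ioi 0)]
    · refine setIntegral_congr_fun measurableSet_Ioi fun y _ => ?_
      simp only [hh, smul_eq_mul, vline]
      rw [mul_left_comm, ← Complex.exp_add]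
      congr 2
      push_cast
      ring
    · intro y hy
      simp [hh, hA0 y (not_lt.1 hy)]
  have hinv := congrFun (hcont.fourierInv_fourier_eq hhint (by rw [hF]; exact hGint)) y
  rw [Real.fourierInv_eq', hF] at hinv
  have hAy : A y = Complex.exp (y * c) * h y := by
    rw [hh, mul_left_comm, ← Complex.exp_add]
    simp
  rw [hAy, ← hinv, ← integral_const_mul]
  refine integral_congr_ae (Eventually.of_forall fun ξ => ?_)
  simp only [smul_eq_mul, vline]
  rw [← mul_assoc, ← Complex.exp_add, mul_comm]
  congr 2
  simp
  ring

/-- `f` has growth at most `C * (1 + |s|) ^ ℓ` in the right half-plane. -/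
def HasGrowth (ℓ C : ℝ) (f : ℂ → ℂ) : Prop :=
  ∀ s : ℂ, 0 < s.re → ‖f s‖ ≤ C * (1 + ‖s‖) ^ ℓ

/-- Submultiplicativity of the weight separates `s` from the integration variable, so the bounds
below keep the factor `(1 + ‖s‖) ^ ℓ`. -/
theorem one_add_norm_add_rpow_le {ℓ : ℝ} (hℓ : 0 ≤ ℓ) (s w : ℂ) :
    (1 + ‖s + w‖) ^ ℓ ≤ (1 + ‖s‖) ^ ℓ * (1 + ‖w‖) ^ ℓ := by
  rw [← Real.mul_rpow (by positivity) (by positivity)]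
  refine Real.rpow_le_rpow (by positivity) ?_ hℓ
  nlinarith [norm_add_le s w, norm_nonneg s, norm_nonneg w]

theorem HasGrowth.nonneg {ℓ C : ℝ} {f : ℂ → ℂ} (hf : HasGrowth ℓ C f) : 0 ≤ C := by
  have h := (norm_nonneg _).trans (hf 1 (by simp))
  exact nonneg_of_mul_nonneg_left h (by positivity)

/-- The Perron integral over the line `Re w = c`. -/
noncomputable def perron (f : ℂ → ℂ) (k : ℕ) (c : ℝ) (s : ℂ) (y : ℝ) : ℂ :=
  ∫ ξ, f (s + vline c ξ) * (Complex.exp (y * vline c ξ) / vline c ξ ^ (k + 1))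

theorem norm_exp_mul_vline (c y ξ : ℝ) : ‖Complex.exp (y * vline c ξ)‖ = Real.exp (y * c) := by
  rw [Complex.norm_exp]
  simp

theorem one_add_norm_vline_rpow_le {c : ℝ} (hc : 0 < c) {ℓ : ℝ} (hℓ : 0 ≤ ℓ) (ξ : ℝ) :
    (1 + ‖vline c ξ‖) ^ ℓ ≤ (c⁻¹ + 1) ^ ℓ * ‖vline c ξ‖ ^ ℓ := by
  rw [← Real.mul_rpow (by positivity) (norm_nonneg _)]
  exact Real.rpow_le_rpow (by positivity) (by linarith [one_le_mul_norm_vline hc ξ]) hℓ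

/-- The exponent `k + 1 - ℓ` exceeds 1 exactly when `k > ℓ`, the condition for this majorant to be
integrable. A free value `z` lets the bound serve both `f` and `deriv f`. -/
theorem norm_div_vline_pow_le {ℓ D : ℝ} (hℓ : 0 ≤ ℓ) {c : ℝ} (hc : 0 < c) {s z : ℂ} (k : ℕ)
    {y ξ : ℝ} (hD : 0 ≤ D) (hz : ‖z‖ ≤ D * (1 + ‖s + vline c ξ‖) ^ ℓ) :
    ‖z * (Complex.exp (y * vline c ξ) / vline c ξ ^ (k + 1))‖ ≤
      D * (1 + ‖s‖) ^ ℓ * (c⁻¹ + 1) ^ ℓ * Real.exp (y * c) * ‖vline c ξ‖ ^ (-((k : ℝ) + 1 - ℓ)) := by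
  have hp := norm_vline_pos hc ξ
  have h1 : ‖z‖ ≤ D * ((1 + ‖s‖) ^ ℓ * ((c⁻¹ + 1) ^ ℓ * ‖vline c ξ‖ ^ ℓ)) :=
    hz.trans (mul_le_mul_of_nonneg_left ((one_add_norm_add_rpow_le hℓ _ _).trans
      (mul_le_mul_of_nonneg_left (one_add_norm_vline_rpow_le hc hℓ ξ) (by positivity))) hD)
  rw [norm_mul, norm_div, norm_exp_mul_vline, norm_pow, neg_sub, Real.rpow_sub hp,
    ← Nat.cast_succ, Real.rpow_natCast]
  refine (mul_le_mul_of_nonneg_right h1 (by positivity)).trans_eq ?_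
  rw [Nat.succ_eq_add_one]
  ring

theorem continuous_comp_add_vline {f : ℂ → ℂ} (hf : ContinuousOn f {s : ℂ | 0 < s.re}) {c : ℝ}
    {s : ℂ} (hs : 0 < s.re + c) : Continuous fun ξ => f (s + vline c ξ) :=
  hf.comp_continuous (continuous_const.add (continuous_vline c)) fun ξ => by simpa using hs

theorem continuous_perron_kernel (k : ℕ) {c : ℝ} (hc : 0 < c) (y : ℝ) :
    Continuous fun ξ => Complex.exp (y * vline c ξ) / vline c ξ ^ (k + 1) :=
  (Complex.continuous_exp.comp (continuous_const.mul (continuous_vline c))).div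
    ((continuous_vline c).pow _) fun ξ => pow_ne_zero _ (vline_ne_zero hc ξ)

theorem integrable_perron {ℓ C : ℝ} (hℓ : 0 ≤ ℓ) {f : ℂ → ℂ}
    (hf : ContinuousOn f {s : ℂ | 0 < s.re}) (hg : HasGrowth ℓ C f) {k : ℕ} (hk : ℓ < k) {c : ℝ}
    (hc : 0 < c) {s : ℂ} (hs : 0 ≤ s.re) (y : ℝ) :
    Integrable fun ξ => f (s + vline c ξ) *
      (Complex.exp (y * vline c ξ) / vline c ξ ^ (k + 1)) :=
  ((integrable_norm_vline_rpow hc (r := (k : ℝ) + 1 - ℓ) (by linarith)).const_mul _).mono'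
    ((continuous_comp_add_vline hf (by linarith)).mul
      (continuous_perron_kernel k hc y)).aestronglyMeasurable
    (Eventually.of_forall fun _ => norm_div_vline_pow_le hℓ hc k hg.nonneg
      (hg _ (by simp; linarith)))

theorem twist_twist (lam : ℕ → ℝ) (a : ℕ → ℂ) (s w : ℂ) :
    twist lam (twist lam a s) w = twist lam a (s + w) := by
  ext n
  rw [twist, twist, twist, mul_assoc, ← Complex.exp_add, mul_add]

/-- Twisting by `w` replaces `s` by `s + w`, so the Riesz sum at `s` has Laplace transform `k! * f
(s + w) / w ^ (k + 1)`. The condition `m + 1 ≤ k` gives the `O(y ^ k)` bound and convergence at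
order `k + 1`; `ℓ < k` makes the transform integrable on the line. -/
theorem rieszSum_eq_perron_of_order_ge {lam : ℕ → ℝ} (hlam : IsFrequency lam) {ℓ C : ℝ}
    (hℓ : 0 ≤ ℓ) {f : ℂ → ℂ} (hf : ContinuousOn f {s : ℂ | 0 < s.re}) (hg : HasGrowth ℓ C f)
    {a : ℕ → ℂ} {m σ : ℝ} (hm : 0 ≤ m) (hσ : 0 ≤ σ)
    (h : ∀ s : ℂ, σ < s.re → Tendsto (fun x : ℝ => rieszMean lam m a x s) atTop (𝓝 (f s)))
    {k : ℕ} (hkm : m + 1 ≤ k) (hkℓ : ℓ < k) {c : ℝ} (hc : 0 < c) {s : ℂ} (hs : σ < s.re) (y : ℝ) :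
    rieszSum lam (twist lam a s) k y = k.factorial * perron f k c s y := by
  have hk0 : k ≠ 0 := by
    rintro rfl
    norm_num at hkm
    linarith
  obtain ⟨M, hM⟩ : ∃ M, ∀ y : ℝ, 0 < y → ‖rieszSum lam (twist lam a s) k y‖ ≤ M * y ^ k := by
    have h1 := tendsto_rieszMean_of_order_le hlam hm (sub_nonneg.2 hkm) (h s hs)
    rw [show m + (k - (m + 1)) + 1 = (k : ℝ) by ring] at h1
    obtain ⟨M, hM⟩ := exists_norm_rieszMean_le hlam k.cast_nonneg h1
    refine ⟨M, fun y hy => ?_⟩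
    have := hM y hy
    rwa [rieszMean_natCast hlam hk0 a hy, norm_div, norm_pow, Complex.norm_real,
      Real.norm_of_nonneg hy.le, div_le_iff₀ (by positivity)] at this
  have hA := continuous_rieszSum hlam (twist lam a s) hk0
  have hlap : ∀ w : ℂ, 0 < w.re → ∫ y in Ioi (0:ℝ), rieszSum lam (twist lam a s) k y *
      Complex.exp (-(y : ℂ) * w) = k.factorial * (f (s + w) / w ^ (k + 1)) := by
    intro w hw
    have hsw := tendsto_rieszSum_of_tendsto_rieszMean hlam hm (k := k + 1)
      (by push_cast; linarith) (h (s + w) (by simp; linarith))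
    rw [← twist_twist] at hsw
    have := eq_laplace_rieszSum hlam hk0 hM hw hsw
    have hw0 : w ≠ 0 := by rintro rfl; simp at hw
    rw [← mul_div_assoc, eq_div_iff (pow_ne_zero _ hw0), mul_comm _ (f _), this, mul_comm]
  have hG : Integrable fun ξ => (k.factorial : ℂ) * (f (s + vline c ξ) / vline c ξ ^ (k + 1)) := by
    have := (integrable_perron hℓ hf hg hkℓ hc (hσ.trans hs.le) 0).const_mul (k.factorial : ℂ)
    simpa [div_eq_mul_inv] using this
  rw [eq_integral_of_laplace hA (fun y hy => rieszSum_of_nonpos hlam _ hk0 hy)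
    (integrableOn_mul_exp_of_le_pow hA hM (by simpa using hc))
    (G := fun w => k.factorial * (f (s + w) / w ^ (k + 1))) (fun ξ => hlap _ (by simpa using hc)) hG,
    perron, ← integral_const_mul]
  refine integral_congr_ae (Eventually.of_forall fun ξ => ?_)
  dsimp only
  ring

theorem hasDerivAt_truncPow {k : ℕ} (hk : k ≠ 0) (x : ℝ) :
    HasDerivAt (truncPow (k + 1)) ((k + 1) * truncPow k x) x := by
  rcases lt_trichotomy x 0 with h | rfl | h
  · rw [truncPow_of_nonpos hk h.le, mul_zero]
    refine (hasDerivAt_const x (0 : ℝ)).congr_of_eventuallyEq ?_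
    filter_upwards [Iio_mem_nhds h] with t ht
    exact truncPow_of_nonpos k.succ_ne_zero (le_of_lt ht)
  · rw [truncPow_of_nonpos hk le_rfl, mul_zero, hasDerivAt_iff_tendsto_slope]
    have h0 : Tendsto (truncPow k) (𝓝[≠] 0) (𝓝 0) := by
      have := (continuous_truncPow k).tendsto 0
      rw [truncPow_of_nonpos hk le_rfl] at this
      exact this.mono_left nhdsWithin_le_nhds
    refine h0.congr' ?_
    filter_upwards [self_mem_nhdsWithin] with t ht
    have ht0 : t ≠ 0 := ht
    rw [slope_def_field, truncPow_of_nonpos k.succ_ne_zero le_rfl, sub_zero, sub_zero]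
    rcases le_total t 0 with h | h
    · rw [truncPow_of_nonpos hk h, truncPow_of_nonpos k.succ_ne_zero h, zero_div]
    · rw [truncPow_of_nonneg _ h, truncPow_of_nonneg _ h, pow_succ, mul_div_cancel_right₀ _ ht0]
  · rw [truncPow_of_nonneg _ h.le]
    have := hasDerivAt_pow (k + 1) x
    simp only [add_tsub_cancel_right, Nat.cast_add, Nat.cast_one] at this
    refine this.congr_of_eventuallyEq ?_
    filter_upwards [Ioi_mem_nhds h] with t ht
    exact truncPow_of_nonneg _ (le_of_lt ht)

theorem hasDerivAt_rieszSum {lam : ℕ → ℝ} (hlam : IsFrequency lam) (c : ℕ → ℂ) {k : ℕ}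
    (hk : k ≠ 0) (y : ℝ) :
    HasDerivAt (rieszSum lam c (k + 1)) ((k + 1) * rieszSum lam c k y) y := by
  obtain ⟨N, hN⟩ := hlam.exists_le (y + 1)
  have h1 : HasDerivAt (fun y => ∑ n ∈ Finset.range N, c n * (truncPow (k + 1) (y - lam n) : ℂ))
      (∑ n ∈ Finset.range N, c n * (((k + 1) * truncPow k (y - lam n) : ℝ) : ℂ)) y := by
    refine HasDerivAt.fun_sum fun n _ => HasDerivAt.const_mul _ (HasDerivAt.ofReal_comp ?_)
    exact (hasDerivAt_truncPow hk (y - lam n)).comp_sub_const y (lam n)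
  rw [rieszSum_eq_sum c hk fun n hn => (lt_add_one y).le.trans (hN n hn), Finset.mul_sum]
  refine (h1.congr_of_eventuallyEq ?_).congr_deriv (Finset.sum_congr rfl fun n _ => ?_)
  · filter_upwards [Iio_mem_nhds (lt_add_one y)] with z hz
    exact rieszSum_eq_sum c k.succ_ne_zero fun n hn => (le_of_lt hz).trans (hN n hn)
  · push_cast
    ring

/-- Differentiating `exp (y w)` brings down a factor `w`, which cancels one power in the
denominator. On `z < y + 1` the exponential is dominated by its value at `y + 1`, since `c > 0`. -/
theorem hasDerivAt_perron {ℓ C : ℝ} (hℓ : 0 ≤ ℓ) {f : ℂ → ℂ}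
    (hf : ContinuousOn f {s : ℂ | 0 < s.re}) (hg : HasGrowth ℓ C f) {k : ℕ} (hk : ℓ < k) {c : ℝ}
    (hc : 0 < c) {s : ℂ} (hs : 0 ≤ s.re) (y : ℝ) :
    HasDerivAt (perron f (k + 1) c s) (perron f k c s y) y := by
  have hmeas : ∀ (j : ℕ) (y : ℝ), AEStronglyMeasurable (fun ξ => f (s + vline c ξ) *
      (Complex.exp (y * vline c ξ) / vline c ξ ^ (j + 1))) := fun j y =>
    ((continuous_comp_add_vline hf (by linarith)).mul
      (continuous_perron_kernel j hc y)).aestronglyMeasurable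
  refine (hasDerivAt_integral_of_dominated_loc_of_deriv_le (s := Iio (y + 1))
    (bound := fun ξ => C * (1 + ‖s‖) ^ ℓ * (c⁻¹ + 1) ^ ℓ * Real.exp ((y + 1) * c) *
      ‖vline c ξ‖ ^ (-((k : ℝ) + 1 - ℓ)))
    (F' := fun z ξ => f (s + vline c ξ) * (Complex.exp (z * vline c ξ) / vline c ξ ^ (k + 1)))
    (Iio_mem_nhds (lt_add_one y)) (Eventually.of_forall fun z => hmeas (k + 1) z)
    (integrable_perron hℓ hf hg (hk.trans (by simp)) hc hs y) (hmeas k y)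
    (Eventually.of_forall fun ξ z hz => ?_)
    ((integrable_norm_vline_rpow hc (r := (k : ℝ) + 1 - ℓ) (by linarith)).const_mul _)
    (Eventually.of_forall fun ξ z _ => ?_)).2
  · refine (norm_div_vline_pow_le hℓ hc k hg.nonneg (hg _ (by simp; linarith))).trans ?_
    have hz' : z < y + 1 := hz
    have := hg.nonneg
    gcongr
  · have h1 : HasDerivAt (fun z : ℂ => Complex.exp (z * vline c ξ))
        (Complex.exp (z * vline c ξ) * (1 * vline c ξ)) (z : ℂ) :=
      ((hasDerivAt_id (z : ℂ)).mul_const (vline c ξ)).cexp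
    refine ((h1.comp_ofReal.div_const (vline c ξ ^ (k + 1 + 1))).const_mul _).congr_deriv ?_
    have := vline_ne_zero hc ξ
    field_simp
    ring

/-- Descent in the order: the formula holds at order `k + K` with `K ≥ m + 1`, and differentiating
both sides in `y` lowers the order by one as long as it stays above `ℓ`. -/
theorem rieszSum_eq_perron_of_re_gt {lam : ℕ → ℝ} (hlam : IsFrequency lam) {ℓ C : ℝ}
    (hℓ : 0 ≤ ℓ) {f : ℂ → ℂ} (hf : ContinuousOn f {s : ℂ | 0 < s.re}) (hg : HasGrowth ℓ C f)
    {a : ℕ → ℂ} {m σ : ℝ} (hm : 0 ≤ m) (hσ : 0 ≤ σ)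
    (h : ∀ s : ℂ, σ < s.re → Tendsto (fun x : ℝ => rieszMean lam m a x s) atTop (𝓝 (f s)))
    {k : ℕ} (hk : ℓ < k) {c : ℝ} (hc : 0 < c) {s : ℂ} (hs : σ < s.re) (y : ℝ) :
    rieszSum lam (twist lam a s) k y = k.factorial * perron f k c s y := by
  obtain ⟨K, hK⟩ := exists_nat_ge (m + 1)
  have step : ∀ j : ℕ, ∀ y : ℝ, rieszSum lam (twist lam a s) (k + (K - j)) y =
      (k + (K - j)).factorial * perron f (k + (K - j)) c s y := by
    intro j
    induction j with
    | zero =>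
      exact rieszSum_eq_perron_of_order_ge hlam hℓ hf hg hm hσ h
        (by rw [Nat.sub_zero]; push_cast; linarith [k.cast_nonneg (α := ℝ)])
        (by push_cast; linarith [K.cast_nonneg (α := ℝ)]) hc hs
    | succ j ih =>
      -- For `j ≥ K` truncated subtraction leaves the order unchanged, so there is nothing to prove.
      rcases Nat.lt_or_ge j K with hj | hj
      swap
      · rwa [show K - (j + 1) = K - j by omega]
      intro y
      obtain ⟨i, hi⟩ : ∃ i, i = k + (K - (j + 1)) := ⟨_, rfl⟩
      rw [show k + (K - j) = i + 1 by omega] at ih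
      rw [← hi]
      have hik : ℓ < i := hk.trans_le (by exact_mod_cast (by omega : k ≤ i))
      have hi0 : i ≠ 0 := by
        rintro rfl
        simp at hik
        linarith
      have h1 := hasDerivAt_rieszSum hlam (twist lam a s) hi0 y
      have h2 := (hasDerivAt_perron hℓ hf hg hik hc (hσ.trans hs.le) y).const_mul
        ((i + 1).factorial : ℂ)
      rw [funext ih] at h1
      have h3 := h1.unique h2
      rw [Nat.factorial_succ] at h3
      push_cast at h3
      rw [mul_assoc] at h3
      exact mul_left_cancel₀ (by exact_mod_cast i.succ_ne_zero) h3
  simpa using step K y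

end RieszDirichlet

namespace RieszDirichlet

/-! ### Perron's formula on the whole half-plane and uniform approximation -/

open MeasureTheory Set

/-- Cauchy's estimate on the disc of radius `u / 2` about `z`, which stays in the half-plane; on it
the weight grows by at most `(1 + u) ^ ℓ`. -/
theorem HasGrowth.norm_deriv_le {ℓ C : ℝ} (hℓ : 0 ≤ ℓ) {f : ℂ → ℂ}
    (hf : DifferentiableOn ℂ f {s : ℂ | 0 < s.re}) (hg : HasGrowth ℓ C f) {u : ℝ} (hu : 0 < u)
    {z : ℂ} (hz : u ≤ z.re) : ‖deriv f z‖ ≤ C * (1 + u) ^ ℓ * (2 / u) * (1 + ‖z‖) ^ ℓ := by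
  have hre : ∀ d : ℂ, dist d z ≤ u / 2 → 0 < d.re := fun d hd => by
    have h1 := Complex.abs_re_le_norm (d - z)
    rw [← dist_eq_norm] at h1
    have h2 := (abs_le.1 (h1.trans hd)).1
    rw [Complex.sub_re] at h2
    linarith
  have hdc : DiffContOnCl ℂ f (Metric.ball z (u / 2)) := by
    refine DifferentiableOn.diffContOnCl (hf.mono fun d hd => ?_)
    exact hre d (Metric.closure_ball_subset_closedBall hd)
  have hC := hg.nonneg
  refine (Complex.norm_deriv_le_of_forall_mem_sphere_norm_le (half_pos hu) hdc
    (C := C * ((1 + ‖z‖) ^ ℓ * (1 + u) ^ ℓ)) fun d hd => ?_).trans_eq ?_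
  · have hd' : dist d z = u / 2 := hd
    refine (hg d (hre d hd'.le)).trans (mul_le_mul_of_nonneg_left ?_ hC)
    have h1 := one_add_norm_add_rpow_le hℓ z (d - z)
    rw [add_sub_cancel, ← dist_eq_norm, hd'] at h1
    refine h1.trans (mul_le_mul_of_nonneg_left ?_ (by positivity))
    exact Real.rpow_le_rpow (by positivity) (by linarith) hℓ
  · field_simp

theorem isOpen_re_pos : IsOpen {s : ℂ | 0 < s.re} :=
  isOpen_lt continuous_const Complex.continuous_re

/-- The integrand only sees points with real part above `c`, so the Cauchy estimate with `u = c`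
dominates the `s`-derivative uniformly for `s` in a bounded set. -/
theorem differentiableOn_perron {ℓ C : ℝ} (hℓ : 0 ≤ ℓ) {f : ℂ → ℂ}
    (hf : DifferentiableOn ℂ f {s : ℂ | 0 < s.re}) (hg : HasGrowth ℓ C f) {k : ℕ} (hk : ℓ < k)
    {c : ℝ} (hc : 0 < c) (y : ℝ) :
    DifferentiableOn ℂ (fun s => perron f k c s y) {s : ℂ | 0 < s.re} := by
  intro s₀ hs₀
  have hs₀' : 0 < s₀.re := hs₀
  have hfc := hf.continuousOn
  have hf' : ContinuousOn (deriv f) {s : ℂ | 0 < s.re} := (hf.deriv isOpen_re_pos).continuousOn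
  have hV : {s : ℂ | 0 < s.re} ∩ {s | ‖s‖ < ‖s₀‖ + 1} ∈ 𝓝 s₀ :=
    inter_mem (isOpen_re_pos.mem_nhds hs₀)
      ((isOpen_lt continuous_norm continuous_const).mem_nhds (by simp))
  refine (hasDerivAt_integral_of_dominated_loc_of_deriv_le
    (F := fun s ξ => f (s + vline c ξ) * (Complex.exp (y * vline c ξ) / vline c ξ ^ (k + 1)))
    (F' := fun s ξ => deriv f (s + vline c ξ) *
      (Complex.exp (y * vline c ξ) / vline c ξ ^ (k + 1)))
    (bound := fun ξ => (C * (1 + c) ^ ℓ * (2 / c)) * (1 + (‖s₀‖ + 1)) ^ ℓ * (c⁻¹ + 1) ^ ℓ *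
      Real.exp (y * c) * ‖vline c ξ‖ ^ (-((k : ℝ) + 1 - ℓ)))
    hV ?_ (integrable_perron hℓ hfc hg hk hc hs₀'.le y) ?_
    (Eventually.of_forall fun ξ s hs => ?_)
    ((integrable_norm_vline_rpow hc (r := (k : ℝ) + 1 - ℓ) (by linarith)).const_mul _)
    (Eventually.of_forall fun ξ s hs => ?_)).2.differentiableAt.differentiableWithinAt
  · filter_upwards [isOpen_re_pos.mem_nhds hs₀] with s hs
    have hs' : 0 < s.re := hs
    exact ((continuous_comp_add_vline hfc (by linarith)).mul
      (continuous_perron_kernel k hc y)).aestronglyMeasurable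
  · exact ((continuous_comp_add_vline hf' (by linarith)).mul
      (continuous_perron_kernel k hc y)).aestronglyMeasurable
  · have hs1 : 0 < s.re := hs.1
    have hs2 : ‖s‖ < ‖s₀‖ + 1 := hs.2
    have hC := hg.nonneg
    refine (norm_div_vline_pow_le hℓ hc k (by positivity)
      (hg.norm_deriv_le hℓ hf hc (by simp; linarith))).trans ?_
    gcongr
  · have hs1 : 0 < s.re := hs.1
    have hd : HasDerivAt f (deriv f (s + vline c ξ)) (s + vline c ξ) :=
      (hf.differentiableAt (isOpen_re_pos.mem_nhds
        (show 0 < (s + vline c ξ).re by simp; linarith))).hasDerivAt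
    exact (hd.comp_add_const s (vline c ξ)).mul_const _

/-- `f` is holomorphic in the right half-plane, of growth at most `C * (1 + |s|) ^ ℓ`, with Riesz
germ `a`. -/
structure IsBoundedGerm (lam : ℕ → ℝ) (ℓ C : ℝ) (f : ℂ → ℂ) (a : ℕ → ℂ) : Prop where
  differentiableOn : DifferentiableOn ℂ f {s : ℂ | 0 < s.re}
  growth : HasGrowth ℓ C f
  germ : IsRieszGerm lam a f

/-- Perron's formula for the Riesz sums of order `k > ℓ`. -/
theorem IsBoundedGerm.rieszSum_eq_perron {lam : ℕ → ℝ} (hlam : IsFrequency lam) {ℓ C : ℝ}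
    (hℓ : 0 ≤ ℓ) {f : ℂ → ℂ} {a : ℕ → ℂ} (hf : IsBoundedGerm lam ℓ C f a) {k : ℕ} (hk : ℓ < k)
    {c : ℝ} (hc : 0 < c) {s : ℂ} (hs : 0 < s.re) (y : ℝ) :
    rieszSum lam (twist lam a s) k y = k.factorial * perron f k c s y := by
  obtain ⟨m, hm, σ, hσ, h⟩ := hf.germ
  have hk0 : k ≠ 0 := by
    rintro rfl
    simp at hk
    linarith
  obtain ⟨N, hN⟩ := hlam.exists_le y
  have hleft : DifferentiableOn ℂ (fun s => rieszSum lam (twist lam a s) k y)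
      {s : ℂ | 0 < s.re} := by
    have : (fun s => rieszSum lam (twist lam a s) k y) = fun s => ∑ n ∈ Finset.range N,
        a n * Complex.exp (-(lam n : ℂ) * s) * (truncPow k (y - lam n) : ℂ) := by
      ext s
      exact rieszSum_eq_sum _ hk0 hN
    rw [this]
    fun_prop
  have hright := (differentiableOn_perron hℓ hf.differentiableOn hf.growth hk hc y).const_mul
    (k.factorial : ℂ)
  -- Identity theorem: both sides are holomorphic on `Re s > 0` and agree near the point `σ + 1`.
  refine (hleft.analyticOnNhd isOpen_re_pos).eqOn_of_preconnected_of_eventuallyEq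
    (hright.analyticOnNhd isOpen_re_pos) (convex_halfSpace_re_gt 0).isPreconnected
    (z₀ := ((σ + 1 : ℝ) : ℂ)) ?_ ?_ hs
  · change 0 < (((σ + 1 : ℝ) : ℂ)).re
    simp
    linarith
  · filter_upwards [(isOpen_lt continuous_const Complex.continuous_re).mem_nhds
      (show σ < (((σ + 1 : ℝ) : ℂ)).re by simp)] with z hz
    exact rieszSum_eq_perron_of_re_gt hlam hℓ hf.differentiableOn.continuousOn hf.growth hm hσ h
      hk hc hz y

/-- The abscissa `1 / y` keeps `exp (y w)` of constant modulus, and rescaling `w` by `y`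
concentrates the arguments of `f` near `s` as `y` grows. -/
theorem perron_inv_eq (f : ℂ → ℂ) (k : ℕ) (s : ℂ) {y : ℝ} (hy : 0 < y) :
    perron f k y⁻¹ s y = (y : ℂ) ^ k *
      ∫ ξ, f (s + vline 1 ξ / y) * (Complex.exp (vline 1 ξ) / vline 1 ξ ^ (k + 1)) := by
  have hy' : (y : ℂ) ≠ 0 := by exact_mod_cast hy.ne'
  have hv : ∀ ξ, vline y⁻¹ (ξ / y) = vline 1 ξ / y := fun ξ => by
    simp only [vline]
    push_cast
    field_simp
  have h := Measure.integral_comp_div (fun ξ => f (s + vline y⁻¹ ξ) *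
    (Complex.exp (y * vline y⁻¹ ξ) / vline y⁻¹ ξ ^ (k + 1))) y
  rw [abs_of_pos hy, Complex.real_smul] at h
  rw [perron, ← mul_right_inj' hy', ← h, ← mul_assoc, ← pow_succ', ← integral_const_mul]
  refine integral_congr_ae (Eventually.of_forall fun ξ => ?_)
  have := vline_ne_zero one_pos ξ
  simp only [hv]
  rw [mul_div_cancel₀ _ hy', div_pow]
  field_simp

/-- Perron's formula for the constant function 1, viewed as a Dirichlet series over `lam n = n` with
single coefficient 1 at `n = 0`, evaluated at `y = 1`. -/
theorem integral_exp_div_vline_pow {k : ℕ} (hk : k ≠ 0) :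
    (k.factorial : ℂ) * ∫ ξ, Complex.exp (vline 1 ξ) / vline 1 ξ ^ (k + 1) = 1 := by
  have hlam : IsFrequency fun n : ℕ => (n : ℝ) :=
    ⟨Nat.strictMono_cast, fun n => n.cast_nonneg, tendsto_natCast_atTop_atTop⟩
  have hgerm : IsRieszGerm (fun n : ℕ => (n : ℝ)) (Pi.single 0 1) fun _ => 1 := by
    refine ⟨0, le_rfl, 0, le_rfl, fun s _ => tendsto_const_nhds.congr' ?_⟩
    filter_upwards [eventually_gt_atTop 0] with x hx
    obtain ⟨N, hN⟩ := hlam.exists_le x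
    have hN0 : 0 < N := by
      by_contra h
      have := hN 0 (by omega)
      simp at this
      linarith
    rw [rieszMean_eq_sum _ _ _ hN, Finset.sum_eq_single_of_mem 0 (Finset.mem_range.2 hN0)]
    · simp [twist, hx]
    · intro n _ hn
      simp [twist, hn]
  have hb : IsBoundedGerm (fun n : ℕ => (n : ℝ)) 0 1 (fun _ => 1) (Pi.single 0 1) :=
    ⟨differentiableOn_const _, fun s _ => by simp, hgerm⟩
  have h := hb.rieszSum_eq_perron hlam le_rfl (k := k) (by exact_mod_cast Nat.pos_of_ne_zero hk)
    one_pos (s := 1) (by simp) 1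
  have hsum : rieszSum (fun n : ℕ => (n : ℝ)) (twist (fun n : ℕ => (n : ℝ)) (Pi.single 0 1) 1) k 1
      = 1 := by
    rw [rieszSum_eq_sum _ hk (N := 1) fun n hn => by exact_mod_cast hn]
    simp [twist, truncPow]
  rw [hsum] at h
  rw [h]
  simp [perron]

/-- Mean value inequality on the convex set `Re z ≥ u`, `‖z - s‖ ≤ ‖w‖`. A separate `r` permits a
weight independent of `y` while the factor `‖w‖` still carries the decay `1 / y`. -/
theorem HasGrowth.norm_sub_le {ℓ C : ℝ} (hℓ : 0 ≤ ℓ) {f : ℂ → ℂ}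
    (hf : DifferentiableOn ℂ f {s : ℂ | 0 < s.re}) (hg : HasGrowth ℓ C f) {u : ℝ} (hu : 0 < u)
    {s w : ℂ} (hs : u ≤ s.re) (hw : 0 ≤ w.re) {r : ℝ} (hr : ‖w‖ ≤ r) :
    ‖f (s + w) - f s‖ ≤ C * (1 + u) ^ ℓ * (2 / u) * (1 + ‖s‖) ^ ℓ * (1 + r) ^ ℓ * ‖w‖ := by
  have hC := hg.nonneg
  have hconv : Convex ℝ ({z : ℂ | u ≤ z.re} ∩ Metric.closedBall s ‖w‖) :=
    (convex_halfSpace_re_ge u).inter (convex_closedBall s _)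
  have := hconv.norm_image_sub_le_of_norm_deriv_le (𝕜 := ℂ) (f := f)
    (C := C * (1 + u) ^ ℓ * (2 / u) * (1 + ‖s‖) ^ ℓ * (1 + r) ^ ℓ) (x := s) (y := s + w)
    (fun z hz => hf.differentiableAt (isOpen_re_pos.mem_nhds (hu.trans_le hz.1)))
    (fun z hz => ?_) ⟨hs, by simp⟩ ⟨?_, by simp⟩
  · simpa using this
  · refine (hg.norm_deriv_le hℓ hf hu hz.1).trans ?_
    rw [mul_assoc (C * (1 + u) ^ ℓ * (2 / u))]
    refine mul_le_mul_of_nonneg_left ?_ (by positivity)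
    have h1 := one_add_norm_add_rpow_le hℓ s (z - s)
    rw [add_sub_cancel] at h1
    refine h1.trans (mul_le_mul_of_nonneg_left ?_ (by positivity))
    have h2 : ‖z - s‖ ≤ ‖w‖ := by simpa [dist_eq_norm] using hz.2
    exact Real.rpow_le_rpow (by positivity) (by linarith) hℓ
  · change u ≤ (s + w).re
    rw [Complex.add_re]
    linarith

/-- Uniform approximation by Riesz means of order `k > ℓ + 1` on the half-plane `Re s ≥ u`. -/
theorem exists_norm_sub_rieszSum_le {lam : ℕ → ℝ} (hlam : IsFrequency lam) {ℓ : ℝ} (hℓ : 0 ≤ ℓ)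
    {k : ℕ} (hk : ℓ + 1 < k) {u : ℝ} (hu : 0 < u) :
    ∃ B : ℝ, ∀ (C : ℝ) (f : ℂ → ℂ) (a : ℕ → ℂ), IsBoundedGerm lam ℓ C f a → ∀ y : ℝ, 1 ≤ y →
      ∀ s : ℂ, u ≤ s.re → ‖f s - rieszSum lam (twist lam a s) k y / (y : ℂ) ^ k‖ ≤
        C * B / y * (1 + ‖s‖) ^ ℓ := by
  have hk0 : k ≠ 0 := by
    rintro rfl
    simp at hk
    linarith
  -- The first two factors come from the Cauchy estimate, `2 ^ ℓ` from `1 + ‖w‖ ≤ 2 * ‖w‖` on `Re w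
  -- = 1`, and `exp 1` from `‖exp w‖` there. What remains is `‖w‖ ^ (ℓ - k)`, integrable because `k
  -- > ℓ + 1`.
  set D := (1 + u) ^ ℓ * (2 / u) * (2 ^ ℓ) * Real.exp 1 with hD
  refine ⟨k.factorial * (D * ∫ ξ, ‖vline 1 ξ‖ ^ (-((k : ℝ) - ℓ))), fun C f a hf y hy s hs => ?_⟩
  have hy0 : 0 < y := by linarith
  have hy' : (y : ℂ) ≠ 0 := by exact_mod_cast hy0.ne'
  have hC := hf.growth.nonneg
  set K : ℝ → ℂ := fun ξ => Complex.exp (vline 1 ξ) / vline 1 ξ ^ (k + 1) with hK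
  have hbound : ∀ ξ, ‖(f s - f (s + vline 1 ξ / y)) * K ξ‖ ≤
      C / y * (1 + ‖s‖) ^ ℓ * D * ‖vline 1 ξ‖ ^ (-((k : ℝ) - ℓ)) := by
    intro ξ
    have hp := norm_vline_pos one_pos ξ
    have hnorm : ‖vline 1 ξ / (y : ℂ)‖ = ‖vline 1 ξ‖ / y := by
      rw [norm_div, Complex.norm_real, Real.norm_of_nonneg hy0.le]
    have h1 := hf.growth.norm_sub_le hℓ hf.differentiableOn hu hs (w := vline 1 ξ / (y : ℂ))
      (by rw [Complex.div_ofReal_re, vline_re]; positivity) (r := ‖vline 1 ξ‖)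
      (by rw [hnorm]; exact div_le_self hp.le hy)
    have h2 := one_add_norm_vline_rpow_le one_pos hℓ ξ
    have h3 := norm_exp_mul_vline 1 1 ξ
    rw [inv_one, show (1 : ℝ) + 1 = 2 by norm_num] at h2
    rw [Complex.ofReal_one, one_mul, mul_one] at h3
    rw [norm_mul, norm_sub_rev, hK, norm_div, h3, norm_pow]
    rw [hnorm] at h1
    have h4 : ‖vline 1 ξ‖ ^ (-((k : ℝ) - ℓ)) =
        ‖vline 1 ξ‖ ^ ℓ * ‖vline 1 ξ‖ / ‖vline 1 ξ‖ ^ (k + 1) := by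
      rw [neg_sub, Real.rpow_sub hp, Real.rpow_natCast]
      field_simp
      ring
    have h5 : C * (1 + u) ^ ℓ * (2 / u) * (1 + ‖s‖) ^ ℓ * (1 + ‖vline 1 ξ‖) ^ ℓ *
        (‖vline 1 ξ‖ / y) ≤ C * (1 + u) ^ ℓ * (2 / u) * (1 + ‖s‖) ^ ℓ *
          (2 ^ ℓ * ‖vline 1 ξ‖ ^ ℓ) * (‖vline 1 ξ‖ / y) := by
      gcongr
    refine (mul_le_mul_of_nonneg_right (h1.trans h5) (by positivity)).trans_eq ?_
    rw [h4, hD]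
    ring
  have hmajor : Integrable fun ξ => C / y * (1 + ‖s‖) ^ ℓ * D * ‖vline 1 ξ‖ ^ (-((k : ℝ) - ℓ)) :=
    (integrable_norm_vline_rpow one_pos (by linarith)).const_mul _
  have hKc : Continuous K := by
    have := continuous_perron_kernel k one_pos 1
    simpa using this
  have hKint : Integrable K := by
    -- A non-integrable kernel would have integral 0 by convention, against its normalisation.
    by_contra h
    have := integral_exp_div_vline_pow hk0
    rw [integral_undef h] at this
    simp at this
  have hfc : Continuous fun ξ => f (s + vline 1 ξ / y) := by
    refine hf.differentiableOn.continuousOn.comp_continuous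
      (continuous_const.add ((continuous_vline 1).div_const _)) fun ξ => ?_
    change 0 < (s + vline 1 ξ / y).re
    have : 0 < s.re := hu.trans_le hs
    rw [Complex.add_re, Complex.div_ofReal_re, vline_re]
    positivity
  have hdiff : Integrable fun ξ => (f s - f (s + vline 1 ξ / y)) * K ξ :=
    hmajor.mono' ((continuous_const.sub hfc).mul hKc).aestronglyMeasurable
      (Eventually.of_forall hbound)
  have hrep : f s - rieszSum lam (twist lam a s) k y / (y : ℂ) ^ k =
      k.factorial * ∫ ξ, (f s - f (s + vline 1 ξ / y)) * K ξ := by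
    have hone := integral_exp_div_vline_pow hk0
    rw [hf.rieszSum_eq_perron hlam hℓ (by linarith) (inv_pos.2 hy0) (hu.trans_le hs) y,
      perron_inv_eq f k s hy0, mul_left_comm, mul_div_cancel_left₀ _ (pow_ne_zero _ hy')]
    have h1 : ∫ ξ, f (s + vline 1 ξ / y) * K ξ =
        f s * (∫ ξ, K ξ) - ∫ ξ, (f s - f (s + vline 1 ξ / y)) * K ξ := by
      rw [← integral_const_mul, ← integral_sub (hKint.const_mul _) hdiff]
      exact integral_congr_ae (Eventually.of_forall fun ξ => by ring)
    rw [h1]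
    linear_combination (-f s) * hone
  have hint := norm_integral_le_of_norm_le hmajor (Eventually.of_forall hbound)
  rw [integral_const_mul] at hint
  rw [hrep, norm_mul, Complex.norm_natCast]
  refine (mul_le_mul_of_nonneg_left hint (by positivity)).trans_eq ?_
  ring

theorem exists_norm_rieszSum_le {lam : ℕ → ℝ} (hlam : IsFrequency lam) {ℓ : ℝ} (hℓ : 0 ≤ ℓ)
    {k : ℕ} (hk : ℓ < k) (y : ℝ) :
    ∃ B : ℝ, ∀ (C : ℝ) (f : ℂ → ℂ) (a : ℕ → ℂ), IsBoundedGerm lam ℓ C f a →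
      ‖rieszSum lam (twist lam a 1) k y‖ ≤ C * B := by
  refine ⟨k.factorial * ((1 + ‖(1 : ℂ)‖) ^ ℓ * ((1 : ℝ)⁻¹ + 1) ^ ℓ * Real.exp (y * 1) *
    ∫ ξ, ‖vline 1 ξ‖ ^ (-((k : ℝ) + 1 - ℓ))), fun C f a hf => ?_⟩
  rw [hf.rieszSum_eq_perron hlam hℓ hk one_pos (by simp) y, norm_mul, Complex.norm_natCast,
    mul_left_comm C]
  refine mul_le_mul_of_nonneg_left ?_ (by positivity)
  refine (norm_integral_le_of_norm_le
    ((integrable_norm_vline_rpow one_pos (r := (k : ℝ) + 1 - ℓ) (by linarith)).const_mul _)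
    (Eventually.of_forall fun ξ => norm_div_vline_pow_le hℓ one_pos k hf.growth.nonneg
      (hf.growth _ (by simp)))).trans_eq ?_
  rw [integral_const_mul]
  ring

end RieszDirichlet

namespace RieszDirichlet

/-! ### Coefficients, tail estimate and limits of bounded sequences -/

open MeasureTheory Set

/-- Triangularity: at `y = lam (n + 1)` only indices up to `n` contribute, and index `n` has
positive weight. Hence Riesz sums determine, and bound, the coefficients one after another. -/
theorem IsFrequency.rieszSum_succ {lam : ℕ → ℝ} (hlam : IsFrequency lam) (c : ℕ → ℂ) {k : ℕ}
    (hk : k ≠ 0) (n : ℕ) :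
    rieszSum lam c k (lam (n + 1)) =
      (∑ j ∈ Finset.range n, c j * (truncPow k (lam (n + 1) - lam j) : ℂ)) +
        c n * (truncPow k (lam (n + 1) - lam n) : ℂ) := by
  rw [rieszSum_eq_sum c hk fun j hj => hlam.strictMono.monotone hj, Finset.sum_range_succ]

theorem IsFrequency.truncPow_succ_pos {lam : ℕ → ℝ} (hlam : IsFrequency lam) (k n : ℕ) :
    0 < truncPow k (lam (n + 1) - lam n) := by
  have := sub_pos.2 (hlam.strictMono n.lt_succ_self)
  rw [truncPow_of_nonneg _ this.le]
  positivity

theorem IsBoundedGerm.unique {lam : ℕ → ℝ} (hlam : IsFrequency lam) {ℓ C : ℝ} (hℓ : 0 ≤ ℓ)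
    {f : ℂ → ℂ} {a b : ℕ → ℂ} (ha : IsBoundedGerm lam ℓ C f a) (hb : IsBoundedGerm lam ℓ C f b) :
    a = b := by
  obtain ⟨k, hk⟩ := exists_nat_gt ℓ
  have hk0 : k ≠ 0 := by
    rintro rfl
    simp at hk
    linarith
  have heq : ∀ y, rieszSum lam (twist lam a 1) k y = rieszSum lam (twist lam b 1) k y := fun y =>
    (ha.rieszSum_eq_perron hlam hℓ hk one_pos (by simp) y).trans
      (hb.rieszSum_eq_perron hlam hℓ hk one_pos (by simp) y).symm
  ext n
  induction n using Nat.strong_induction_on with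
  | _ n ih =>
    have h := heq (lam (n + 1))
    rw [hlam.rieszSum_succ _ hk0, hlam.rieszSum_succ _ hk0, Finset.sum_congr rfl fun j hj => by
      rw [twist, ih j (Finset.mem_range.1 hj), ← twist], add_right_inj] at h
    have h2 := mul_right_cancel₀
      (Complex.ofReal_ne_zero.2 (hlam.truncPow_succ_pos k n).ne') h
    exact mul_right_cancel₀ (Complex.exp_ne_zero _) h2

/-- The Perron integral bounds the Riesz sum at `lam (n + 1)` linearly in `C`; isolating its last
term and bounding the earlier ones by induction gives a `B` independent of `f`. -/
theorem exists_norm_coeff_le {lam : ℕ → ℝ} (hlam : IsFrequency lam) {ℓ : ℝ} (hℓ : 0 ≤ ℓ) (n : ℕ) :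
    ∃ B : ℝ, ∀ (C : ℝ) (f : ℂ → ℂ) (a : ℕ → ℂ), IsBoundedGerm lam ℓ C f a → ‖a n‖ ≤ C * B := by
  obtain ⟨k, hk⟩ := exists_nat_gt ℓ
  have hk0 : k ≠ 0 := by
    rintro rfl
    simp at hk
    linarith
  induction n using Nat.strong_induction_on with
  | _ n ih =>
    choose! B hB using ih
    obtain ⟨B', hB'⟩ := exists_norm_rieszSum_le hlam hℓ hk (lam (n + 1))
    set e : ℕ → ℝ := fun j => ‖Complex.exp (-(lam j : ℂ) * 1)‖ with he
    have hpos := hlam.truncPow_succ_pos k n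
    have hen : 0 < e n := norm_pos_iff.2 (Complex.exp_ne_zero _)
    refine ⟨(B' + ∑ j ∈ Finset.range n, B j * e j * truncPow k (lam (n + 1) - lam j)) /
      (e n * truncPow k (lam (n + 1) - lam n)), fun C f a hf => ?_⟩
    have h1 := hB' C f a hf
    rw [hlam.rieszSum_succ _ hk0] at h1
    have h2 := norm_le_add_norm_add
      (twist lam a 1 n * (truncPow k (lam (n + 1) - lam n) : ℂ))
      (∑ j ∈ Finset.range n, twist lam a 1 j * (truncPow k (lam (n + 1) - lam j) : ℂ))
    rw [add_comm (_ * _)] at h2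
    have h3 : ‖∑ j ∈ Finset.range n, twist lam a 1 j * (truncPow k (lam (n + 1) - lam j) : ℂ)‖ ≤
        ∑ j ∈ Finset.range n, C * (B j * e j * truncPow k (lam (n + 1) - lam j)) := by
      refine (norm_sum_le _ _).trans (Finset.sum_le_sum fun j hj => ?_)
      rw [twist, norm_mul, norm_mul, Complex.norm_real, Real.norm_of_nonneg (truncPow_nonneg _ _),
        ← mul_assoc, ← mul_assoc]
      exact mul_le_mul_of_nonneg_right (mul_le_mul_of_nonneg_right
        (hB j (Finset.mem_range.1 hj) C f a hf) (norm_nonneg _)) (truncPow_nonneg _ _)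
    rw [← Finset.mul_sum] at h3
    rw [twist, norm_mul, norm_mul, Complex.norm_real, Real.norm_of_nonneg hpos.le] at h2
    rw [← mul_div_assoc, le_div_iff₀ (by positivity), ← mul_assoc, mul_add]
    exact h2.trans (add_le_add h1 h3)

theorem growthNorm_le_iff {ℓ : ℝ} {C : ℝ} (hC : 0 ≤ C) {f : ℂ → ℂ} :
    growthNorm ℓ f ≤ ENNReal.ofReal C ↔ HasGrowth ℓ C f := by
  simp only [growthNorm, iSup_le_iff, HasGrowth]
  refine forall₂_congr fun s _ => ?_
  rw [ENNReal.ofReal_le_ofReal_iff hC, div_le_iff₀ (by positivity)]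

theorem isBoundedGerm_bohrCoeff {lam : ℕ → ℝ} {ℓ : ℝ} {f : ℂ → ℂ} (hf : f ∈ HSpace lam ℓ)
    {C : NNReal} (hC : growthNorm ℓ f ≤ C) : IsBoundedGerm lam ℓ C f (bohrCoeff lam f) := by
  refine ⟨hf.1, (growthNorm_le_iff C.coe_nonneg).1 (by simpa using hC), ?_⟩
  rw [bohrCoeff, dif_pos hf.2.1]
  exact hf.2.1.choose_spec

theorem IsBoundedGerm.mem_HSpace {lam : ℕ → ℝ} {ℓ C : ℝ} {f : ℂ → ℂ} {a : ℕ → ℂ}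
    (hf : IsBoundedGerm lam ℓ C f a) : f ∈ HSpace lam ℓ :=
  ⟨hf.differentiableOn, ⟨a, hf.germ⟩,
    ((growthNorm_le_iff hf.growth.nonneg).2 hf.growth).trans_lt ENNReal.ofReal_lt_top⟩

theorem IsBoundedGerm.bohrCoeff_eq {lam : ℕ → ℝ} (hlam : IsFrequency lam) {ℓ C : ℝ} (hℓ : 0 ≤ ℓ)
    {f : ℂ → ℂ} {a : ℕ → ℂ} (hf : IsBoundedGerm lam ℓ C f a) : bohrCoeff lam f = a := by
  refine IsBoundedGerm.unique hlam hℓ ⟨hf.differentiableOn, hf.growth, ?_⟩ hf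
  have h : ∃ a, IsRieszGerm lam a f := ⟨a, hf.germ⟩
  rw [bohrCoeff, dif_pos h]
  exact h.choose_spec

theorem rieszMean_twist (lam : ℕ → ℝ) (m : ℝ) (a : ℕ → ℂ) (x : ℝ) (u s : ℂ) :
    rieszMean lam m (twist lam a u) x s = rieszMean lam m a x (u + s) := by
  simp only [rieszMean]
  refine finsum_congr fun n => finsum_congr fun _ => ?_
  rw [twist, mul_assoc (a n), ← Complex.exp_add, mul_add]

theorem IsBoundedGerm.translate {lam : ℕ → ℝ} {ℓ C : ℝ} (hℓ : 0 ≤ ℓ) {f : ℂ → ℂ} {a : ℕ → ℂ}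
    (hf : IsBoundedGerm lam ℓ C f a) {u : ℝ} (hu : 0 ≤ u) :
    IsBoundedGerm lam ℓ (C * (1 + u) ^ ℓ) (translate u f) (twist lam a u) := by
  refine ⟨?_, fun s hs => ?_, ?_⟩
  · refine hf.differentiableOn.comp (by fun_prop) fun s hs => ?_
    have hs' : 0 < s.re := hs
    change 0 < ((u : ℂ) + s).re
    simp
    linarith
  · refine (hf.growth _ (by simp; linarith)).trans ?_
    rw [mul_assoc]
    refine mul_le_mul_of_nonneg_left ?_ hf.growth.nonneg
    have := one_add_norm_add_rpow_le hℓ (u : ℂ) s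
    rwa [Complex.norm_real, Real.norm_of_nonneg hu] at this
  · obtain ⟨m, hm, σ, hσ, h⟩ := hf.germ
    refine ⟨m, hm, σ, hσ, fun s hs => ?_⟩
    simp only [rieszMean_twist]
    exact h _ (by simp; linarith)

/-- For `Re s ≥ 0` each factor `exp (-lam n * s) * (y - lam n)₊ ^ k / y ^ k` has modulus at most 1,
which makes the bound uniform in `s`. -/
theorem norm_rieszSum_sub_le {lam : ℕ → ℝ} (hlam : IsFrequency lam) {k : ℕ} (hk : k ≠ 0)
    (a b : ℕ → ℂ) {s : ℂ} (hs : 0 ≤ s.re) {N : ℕ} {y : ℝ} (hy : 0 < y)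
    (hN : ∀ n, N ≤ n → y ≤ lam n) :
    ‖rieszSum lam (twist lam a s) k y / (y : ℂ) ^ k -
      rieszSum lam (twist lam b s) k y / (y : ℂ) ^ k‖ ≤ ∑ n ∈ Finset.range N, ‖a n - b n‖ := by
  rw [rieszSum_eq_sum _ hk hN, rieszSum_eq_sum _ hk hN, ← sub_div, ← Finset.sum_sub_distrib,
    Finset.sum_div]
  refine (norm_sum_le _ _).trans (Finset.sum_le_sum fun n _ => ?_)
  have h1 : (twist lam a s n * (truncPow k (y - lam n) : ℂ) -
      twist lam b s n * (truncPow k (y - lam n) : ℂ)) / (y : ℂ) ^ k =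
      (a n - b n) * (Complex.exp (-(lam n : ℂ) * s) * (truncPow k (y - lam n) / y ^ k : ℝ)) := by
    simp only [twist]
    push_cast
    ring
  rw [h1, norm_mul]
  refine mul_le_of_le_one_right (norm_nonneg _) ?_
  have h0 := truncPow_nonneg k (y - lam n)
  rw [norm_mul, Complex.norm_real, Real.norm_of_nonneg (by positivity)]
  refine mul_le_one₀ ?_ (by positivity) (div_le_one_of_le₀ ?_ (by positivity))
  · rw [Complex.norm_exp, Real.exp_le_one_iff]
    simpa using mul_nonneg (hlam.nonneg n) hs
  · exact pow_le_pow_left₀ (le_max_right _ _)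
      (max_le (by linarith [hlam.nonneg n]) hy.le) _

/-- The tail estimate behind the Montel theorem: two functions of bounded growth are uniformly close
on `Re s ≥ u` once finitely many of their coefficients are. -/
theorem exists_norm_sub_le {lam : ℕ → ℝ} (hlam : IsFrequency lam) {ℓ : ℝ} (hℓ : 0 ≤ ℓ) (C : ℝ)
    {u ε : ℝ} (hu : 0 < u) (hε : 0 < ε) :
    ∃ N : ℕ, ∀ (f g : ℂ → ℂ) (a b : ℕ → ℂ), IsBoundedGerm lam ℓ C f a → IsBoundedGerm lam ℓ C g b →
      ∀ s : ℂ, u ≤ s.re → ‖f s - g s‖ ≤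
        (ε + ∑ n ∈ Finset.range N, ‖a n - b n‖) * (1 + ‖s‖) ^ ℓ := by
  obtain ⟨k, hk⟩ := exists_nat_gt (ℓ + 1)
  have hk0 : k ≠ 0 := by
    rintro rfl
    simp at hk
    linarith
  obtain ⟨B, hB⟩ := exists_norm_sub_rieszSum_le hlam hℓ hk hu
  have hlim : Tendsto (fun y : ℝ => C * B / y) atTop (𝓝 0) := tendsto_const_nhds.div_atTop tendsto_id
  -- Each of the two approximation errors is allowed `ε / 2`; `N` depends only on this `y`, not on
  -- the functions.
  obtain ⟨y, hy1, hy⟩ := ((eventually_ge_atTop 1).and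
    (hlim.eventually_le_const (half_pos hε))).exists
  obtain ⟨N, hN⟩ := hlam.exists_le y
  refine ⟨N, fun f g a b hf hg s hs => ?_⟩
  have h1 := hB C f a hf y hy1 s hs
  have h2 := hB C g b hg y hy1 s hs
  have h3 := norm_rieszSum_sub_le hlam hk0 a b (hu.le.trans hs) (by linarith) hN
  have hone : 1 ≤ (1 + ‖s‖) ^ ℓ := Real.one_le_rpow (by linarith [norm_nonneg s]) hℓ
  have hS : 0 ≤ ∑ n ∈ Finset.range N, ‖a n - b n‖ := Finset.sum_nonneg fun _ _ => norm_nonneg _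
  set R := rieszSum lam (twist lam a s) k y / (y : ℂ) ^ k
  set R' := rieszSum lam (twist lam b s) k y / (y : ℂ) ^ k
  rw [norm_sub_rev] at h2
  have h4 : ‖f s - g s‖ ≤ ‖f s - R‖ + ‖R - R'‖ + ‖R' - g s‖ := by
    have := norm_add₃_le (a := f s - R) (b := R - R') (c := R' - g s)
    simpa using this
  have h5 := mul_le_mul_of_nonneg_right hy (zero_le_one.trans hone)
  have h6 := le_mul_of_one_le_right hS hone
  rw [add_mul]
  linarith

theorem tendsto_sum_norm_sub {a : ℕ → ℕ → ℂ} {b : ℕ → ℂ}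
    (h : ∀ n, Tendsto (fun N => a N n) atTop (𝓝 (b n))) (m : ℕ) :
    Tendsto (fun N => ∑ n ∈ Finset.range m, ‖a N n - b n‖) atTop (𝓝 0) := by
  have := tendsto_finsetSum (Finset.range m) fun n _ => ((h n).sub_const (b n)).norm
  simpa using this

/-- A bounded sequence with convergent coefficients converges locally uniformly, and its limit has
the limit coefficients. -/
theorem exists_limit {lam : ℕ → ℝ} (hlam : IsFrequency lam) {ℓ C : ℝ} (hℓ : 0 ≤ ℓ)
    {F : ℕ → ℂ → ℂ} {a : ℕ → ℕ → ℂ} {b : ℕ → ℂ} (hF : ∀ N, IsBoundedGerm lam ℓ C (F N) (a N))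
    (h : ∀ n, Tendsto (fun N => a N n) atTop (𝓝 (b n))) :
    ∃ f : ℂ → ℂ, IsBoundedGerm lam ℓ C f b := by
  have hcauchy : ∀ u : ℝ, 0 < u → ∀ ε > 0, ∃ N₀, ∀ M ≥ N₀, ∀ N ≥ N₀, ∀ s : ℂ, u ≤ s.re →
      ‖F M s - F N s‖ ≤ ε * (1 + ‖s‖) ^ ℓ := by
    intro u hu ε hε
    obtain ⟨m, hm⟩ := exists_norm_sub_le hlam hℓ C hu (ε := ε / 3) (by positivity)
    obtain ⟨N₀, hN₀⟩ := eventually_atTop.1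
      ((tendsto_sum_norm_sub h m).eventually_le_const (show (0:ℝ) < ε / 3 by positivity))
    refine ⟨N₀, fun M hM N hN s hs => (hm _ _ _ _ (hF M) (hF N) s hs).trans
      (mul_le_mul_of_nonneg_right ?_ (by positivity))⟩
    have h1 : ∑ n ∈ Finset.range m, ‖a M n - a N n‖ ≤
        ∑ n ∈ Finset.range m, ‖a M n - b n‖ + ∑ n ∈ Finset.range m, ‖a N n - b n‖ := by
      rw [← Finset.sum_add_distrib]
      refine Finset.sum_le_sum fun n _ => ?_
      rw [norm_sub_rev (a N n)]
      exact norm_sub_le_norm_sub_add_norm_sub _ _ _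
    linarith [hN₀ M hM, hN₀ N hN]
  have hlim : ∀ s : ℂ, 0 < s.re → ∃ z, Tendsto (fun N => F N s) atTop (𝓝 z) := by
    intro s hs
    refine cauchySeq_tendsto_of_complete (Metric.cauchySeq_iff.2 fun ε hε => ?_)
    -- Pointwise convergence uses the half-plane bounded by the vertical line through `s` itself.
    obtain ⟨N₀, hN₀⟩ := hcauchy s.re hs (ε / 2 / (1 + ‖s‖) ^ ℓ) (by positivity)
    refine ⟨N₀, fun M hM N hN => ?_⟩
    have := hN₀ M hM N hN s le_rfl
    rw [div_mul_cancel₀ _ (by positivity)] at this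
    rw [dist_eq_norm]
    linarith
  choose! f hf using hlim
  have hunif : ∀ u : ℝ, 0 < u → ∀ ε > 0, ∃ N₀, ∀ N ≥ N₀, ∀ s : ℂ, u ≤ s.re →
      ‖f s - F N s‖ ≤ ε * (1 + ‖s‖) ^ ℓ := by
    intro u hu ε hε
    obtain ⟨N₀, hN₀⟩ := hcauchy u hu ε hε
    refine ⟨N₀, fun N hN s hs => le_of_tendsto
      (((hf s (hu.trans_le hs)).sub_const (F N s)).norm) ?_⟩
    filter_upwards [eventually_ge_atTop N₀] with M hM
    exact hN₀ M hM N hN s hs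
  refine ⟨f, ?_, fun s hs => ?_, ?_⟩
  · refine TendstoLocallyUniformlyOn.differentiableOn (F := F) (φ := atTop) ?_
      (Eventually.of_forall fun N => (hF N).differentiableOn) isOpen_re_pos
    rw [Metric.tendstoLocallyUniformlyOn_iff]
    intro ε hε s hs
    have hs' : 0 < s.re := hs
    refine ⟨{z | s.re / 2 < z.re} ∩ {z | ‖z‖ < ‖s‖ + 1}, mem_nhdsWithin_of_mem_nhds (inter_mem
      ((isOpen_lt continuous_const Complex.continuous_re).mem_nhds (half_lt_self hs'))
      ((isOpen_lt continuous_norm continuous_const).mem_nhds (by simp))), ?_⟩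
    obtain ⟨N₀, hN₀⟩ := hunif (s.re / 2) (half_pos hs') (ε / 2 / (1 + (‖s‖ + 1)) ^ ℓ)
      (by positivity)
    filter_upwards [eventually_ge_atTop N₀] with N hN z hz
    have hz1 : s.re / 2 < z.re := hz.1
    have hz2 : ‖z‖ < ‖s‖ + 1 := hz.2
    rw [dist_eq_norm]
    calc ‖f z - F N z‖ ≤ ε / 2 / (1 + (‖s‖ + 1)) ^ ℓ * (1 + ‖z‖) ^ ℓ := hN₀ N hN z hz1.le
      _ ≤ ε / 2 / (1 + (‖s‖ + 1)) ^ ℓ * (1 + (‖s‖ + 1)) ^ ℓ := by gcongr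
      _ = ε / 2 := div_mul_cancel₀ _ (by positivity)
      _ < ε := half_lt_self hε
  · exact le_of_tendsto (hf s hs).norm (Eventually.of_forall fun N => (hF N).growth s hs)
  · obtain ⟨k, hk⟩ := exists_nat_gt (ℓ + 1)
    have hk0 : k ≠ 0 := by
      rintro rfl
      simp at hk
      linarith
    -- The germ of the limit works with order `k > ℓ + 1` and `σ = 0`: at fixed `y` the
    -- approximation bound passes to the limit in `N`, and then `y → ∞`.
    refine ⟨k, k.cast_nonneg, 0, le_rfl, fun s hs => ?_⟩
    obtain ⟨B, hB⟩ := exists_norm_sub_rieszSum_le hlam hℓ hk hs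
    have hest : ∀ y : ℝ, 1 ≤ y → ‖rieszMean lam k b y s - f s‖ ≤ C * B / y * (1 + ‖s‖) ^ ℓ := by
      intro y hy
      have hy0 : 0 < y := by linarith
      obtain ⟨m, hm⟩ := hlam.exists_le y
      rw [rieszMean_natCast hlam hk0 b hy0, norm_sub_rev]
      have hR : Tendsto (fun N => rieszSum lam (twist lam (a N) s) k y / (y : ℂ) ^ k) atTop
          (𝓝 (rieszSum lam (twist lam b s) k y / (y : ℂ) ^ k)) := by
        rw [tendsto_iff_norm_sub_tendsto_zero]
        exact squeeze_zero (fun _ => norm_nonneg _)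
          (fun N => norm_rieszSum_sub_le hlam hk0 (a N) b hs.le hy0 hm) (tendsto_sum_norm_sub h m)
      exact le_of_tendsto ((hf s hs).sub hR).norm
        (Eventually.of_forall fun N => hB C (F N) (a N) (hF N) y hy s le_rfl)
    rw [tendsto_iff_norm_sub_tendsto_zero]
    have h0 : Tendsto (fun y : ℝ => C * B / y * (1 + ‖s‖) ^ ℓ) atTop (𝓝 0) := by
      simpa using (tendsto_const_nhds.div_atTop tendsto_id : Tendsto (fun y : ℝ => C * B / y)
        atTop (𝓝 0)).mul_const ((1 + ‖s‖) ^ ℓ)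
    exact squeeze_zero' (Eventually.of_forall fun _ => norm_nonneg _)
      ((eventually_ge_atTop 1).mono hest) h0

theorem convergesInH_translate {lam : ℕ → ℝ} (hlam : IsFrequency lam) {ℓ C : ℝ} (hℓ : 0 ≤ ℓ)
    {F : ℕ → ℂ → ℂ} {f : ℂ → ℂ} {a : ℕ → ℕ → ℂ} {b : ℕ → ℂ}
    (hF : ∀ N, IsBoundedGerm lam ℓ C (F N) (a N)) (hf : IsBoundedGerm lam ℓ C f b)
    (h : ∀ n, Tendsto (fun N => a N n) atTop (𝓝 (b n))) {u : ℝ} (hu : 0 < u) :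
    ConvergesInH lam ℓ (fun N => translate u (F N)) (translate u f) := by
  refine ⟨fun N => ((hF N).translate hℓ hu.le).mem_HSpace, (hf.translate hℓ hu.le).mem_HSpace, ?_⟩
  rw [ENNReal.tendsto_nhds_zero]
  intro ε hε
  rcases eq_or_ne ε ⊤ with rfl | hεtop
  · exact Eventually.of_forall fun _ => le_top
  have hδ : 0 < ε.toReal := ENNReal.toReal_pos hε.ne' hεtop
  have hU : 0 < (1 + u) ^ ℓ := by positivity
  -- Chosen so that `2 * δ * (1 + u) ^ ℓ = ε.toReal`: one `δ` for the tail, one for the finitely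
  -- many coefficients, and `(1 + u) ^ ℓ` from translating the weight.
  set δ := ε.toReal / (1 + u) ^ ℓ / 2 with hδdef
  have hδ' : 0 < δ := by positivity
  obtain ⟨m, hm⟩ := exists_norm_sub_le hlam hℓ C hu hδ'
  filter_upwards [(tendsto_sum_norm_sub h m).eventually_le_const hδ'] with N hN
  rw [← ENNReal.ofReal_toReal hεtop, growthNorm_le_iff hδ.le]
  intro s hs
  have h1 := hm _ _ _ _ (hF N) hf ((u : ℂ) + s) (by simp; linarith)
  have h2 := one_add_norm_add_rpow_le hℓ (u : ℂ) s
  rw [Complex.norm_real, Real.norm_of_nonneg hu.le] at h2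
  calc ‖translate u (F N) s - translate u f s‖
      ≤ (δ + ∑ n ∈ Finset.range m, ‖a N n - b n‖) * (1 + ‖(u : ℂ) + s‖) ^ ℓ := h1
    _ ≤ (δ + δ) * ((1 + u) ^ ℓ * (1 + ‖s‖) ^ ℓ) := by gcongr
    _ = ε.toReal * (1 + ‖s‖) ^ ℓ := by
      rw [hδdef]
      field_simp
      ring

end RieszDirichlet

/-! ### The Montel theorem -/

theorem mainTheorem5 (lam : ℕ → ℝ) (hlam : RieszDirichlet.IsFrequency lam)
    (ℓ : ℝ) (hℓ : 0 ≤ ℓ) :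
    (∀ (F : ℕ → ℂ → ℂ) (a : ℕ → ℂ), RieszDirichlet.IsBoundedSeq lam ℓ F →
      (∀ n, Tendsto (fun N => RieszDirichlet.bohrCoeff lam (F N) n) atTop (𝓝 (a n))) →
      ∃ f ∈ RieszDirichlet.HSpace lam ℓ,
        (∀ n, RieszDirichlet.bohrCoeff lam f n = a n) ∧
        ∀ u : ℝ, 0 < u →
          RieszDirichlet.ConvergesInH lam ℓ
            (fun N => RieszDirichlet.translate u (F N)) (RieszDirichlet.translate u f)) ∧
    (∀ F : ℕ → ℂ → ℂ, RieszDirichlet.IsBoundedSeq lam ℓ F →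
      ∃ φ : ℕ → ℕ, StrictMono φ ∧ ∃ f ∈ RieszDirichlet.HSpace lam ℓ,
        ∀ u : ℝ, 0 < u →
          RieszDirichlet.ConvergesInH lam ℓ
            (fun j => RieszDirichlet.translate u (F (φ j))) (RieszDirichlet.translate u f)) := by
  constructor
  · rintro F a ⟨hmem, C, hC⟩ ha
    have hF := fun N => RieszDirichlet.isBoundedGerm_bohrCoeff (hmem N) (hC N)
    obtain ⟨f, hf⟩ := RieszDirichlet.exists_limit hlam hℓ hF ha
    exact ⟨f, hf.mem_HSpace, congrFun (hf.bohrCoeff_eq hlam hℓ),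
      fun u hu => RieszDirichlet.convergesInH_translate hlam hℓ hF hf ha hu⟩
  · rintro F ⟨hmem, C, hC⟩
    have hF := fun N => RieszDirichlet.isBoundedGerm_bohrCoeff (hmem N) (hC N)
    choose B hB using fun n => RieszDirichlet.exists_norm_coeff_le hlam hℓ n
    -- Tychonoff on the product of coefficient discs takes the place of a diagonal argument.
    have hcompact : IsCompact (Set.univ.pi fun n => Metric.closedBall (0 : ℂ) (C * B n)) :=
      isCompact_univ_pi fun n => isCompact_closedBall _ _
    obtain ⟨b, -, φ, hφ, hlim⟩ := hcompact.tendsto_subseq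
      (x := fun N => RieszDirichlet.bohrCoeff lam (F N))
      fun N n _ => by simpa using hB n C _ _ (hF N)
    have hb := tendsto_pi_nhds.1 hlim
    obtain ⟨f, hf⟩ := RieszDirichlet.exists_limit hlam hℓ (fun j => hF (φ j)) hb
    exact ⟨φ, hφ, f, hf.mem_HSpace, fun u hu =>
      RieszDirichlet.convergesInH_translate hlam hℓ (fun j => hF (φ j)) hf hb hu⟩
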